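/- **Setting.** Identify $\mathbb{R}^2$ with $\mathbb{C}$, let $\theta_{\mathbf x}$ be the polar angle of $\mathbf x$, and let $H_n=H^{(1)}_n=J_n+\mathrm{i}Y_n$. Let $k>0$ be the wave number, $p\ge 0$ an integer (the truncation number), and $\mathbf y_j$ finitely many field points with complex weights $q_j=\varphi(\mathbf y_j)s(\mathbf y_j)$. A square (the cell of level $0$) covers the points and carries a finite quadtree: some cells are divided into four equal cells of the next level, the others are leaves. $\mathbf O_C$ is the centroid of the cell $C$; two cells are adjacent if their closed squares meet. The well separated cells $\mathcal{DI}_i$ $(1\le i\le n_{D})$ of a cell $D$ of level $L\ge 2$ are the cells of the tree that contain field points, are not adjacent to $D$, and are either of level $L$ with a parent adjacent to the parent of $D$, or leaves of a level $<L$ adjacent to the parent of $D$. It is assumed that the level of $\mathcal{DI}_i$ is always at least $L-2$. **Moments.** For $n,m\in\mathbb{Z}$: * $\mathbf M_n(\mathbf O_C)=\sum_{\mathbf y_j\in C}J_n(k|\mathbf y_j-\mathbf O_C|)e^{-\mathrm{i}n\theta_{\mathbf y_j-\mathbf O_C}}q_j$. The computed moment is $\widetilde{\mathbf M}_n(\mathbf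 O_C,p)=\mathbf M_n(\mathbf O_C)$ if $C$ is a leaf, and otherwise $\widetilde{\mathbf M}_n(\mathbf O_C,p)=\sum_{C'}\sum_{l=-p}^{p}\widetilde{\mathbf M}_l(\mathbf O_{C'},p)J_{n-l}(k|\mathbf O_{C'}-\mathbf O_C|)e^{-\mathrm{i}(n-l)\theta_{\mathbf O_{C'}-\mathbf O_C}}$ over the nonempty children $C'$ of $C$. The error is $EM_n=\mathbf M_n-\widetilde{\mathbf M}_n$. * For a cell $\mathcal D_L$ of level $L\ge2$ with ancestors $\mathcal D_{L-1},\dots,\mathcal D_2$ of the levels $L-1,\dots,2$, the exact local moments are $\mathbf L_m(\mathbf O_{\mathcal D_L})=\sum_{i}\sum_{n=-\infty}^{\infty}\mathbf M_n(\mathbf O_{\mathcal{DI}_i})H_{n-m}(k|\mathbf O_{\mathcal D_L}-\mathbf O_{\mathcal{DI}_i}|)e^{\mathrm{i}(n-m)\theta_{\mathbf O_{\mathcal D_L}-\mathbf O_{\mathcal{DI}_i}}}$, to which, if $L\ge3$, $\sum_{l=-\infty}^{\infty}\mathbf L_l(\mathbf O_{\mathcal D_{L-1}})J_{l-m}(k|\mathbf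 O_{\mathcal D_L}-\mathbf O_{\mathcal D_{L-1}}|)e^{\mathrm{i}(l-m)\theta_{\mathbf O_{\mathcal D_L}-\mathbf O_{\mathcal D_{L-1}}}}$ is added. The computed local moments $\widetilde{\mathbf L}_m(\mathbf O_{\mathcal D_L},p)$ are given by the same recursion with $\widetilde{\mathbf M},\widetilde{\mathbf L}$ in place of $\mathbf M,\mathbf L$ and both infinite sums truncated to $-p,\dots,p$. The error is $EL_m=\mathbf L_m-\widetilde{\mathbf L}_m$. **Remainders.** $$R^H_{m,p}(\mathbf x,\mathbf y)=\Big(\sum_{n=p+1}^{\infty}+\sum_{n=-\infty}^{-p-1}\Big)H_{m+n}(|\mathbf x|)e^{\mathrm{i}(m+n)\theta_{\mathbf x}}J_n(|\mathbf y|)e^{-\mathrm{i}n\theta_{\mathbf y}},$$ $$\overline R^H_{m,p}(\mathbf x,\mathbf y)=\Big(\sum_{n=p-m+1}^{\infty}+\sum_{n=-\infty}^{-p-m-1}\Big)H_{m+n}(|\mathbf x|)e^{-\mathrm{i}(m+n)\theta_{\mathbf x}}J_n(|\mathbf y|)e^{\mathrm{i}n\theta_{\mathbf y}}.$$ **Theorem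 2.** For each cell $\mathcal D_L$ of level $L\ge2$ of the tree and each $m\in\mathbb{Z}$, all the infinite series below and in the definition of the exact local moments converge absolutely, and with $$ELM_m(\mathbf O_{\mathcal D_L},p)=\sum_{i=1}^{n_{\mathcal D_L}}\Big(\sum_{n=-p}^{p}EM_n(\mathbf O_{\mathcal{DI}_i},p)H_{n-m}(k|\mathbf O_{\mathcal D_L}-\mathbf O_{\mathcal{DI}_i}|)e^{\mathrm{i}(n-m)\theta_{\mathbf O_{\mathcal D_L}-\mathbf O_{\mathcal{DI}_i}}}+\sum_{\mathbf y_j\in\mathcal{DI}_i}R^H_{-m,p}\big(k(\mathbf O_{\mathcal D_L}-\mathbf O_{\mathcal{DI}_i}),k(\mathbf y_j-\mathbf O_{\mathcal{DI}_i})\big)q_j\Big)$$ (the $\mathcal{DI}_i$ being the well separated cells of $\mathcal D_L$) one has $EL_m(\mathbf O_{\mathcal D_2},p)=ELM_m(\mathbf O_{\mathcal D_2},p)$ when $L=2$, and when $L\ge3$ $$EL_m(\mathbf O_{\mathcal D_L},p)=ELM_m(\mathbf O_{\mathcal D_L},p)+\sum_{l=-p}^{p}EL_l(\mathbf O_{\mathcal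 D_{L-1}},p)J_{l-m}(k|\mathbf O_{\mathcal D_L}-\mathbf O_{\mathcal D_{L-1}}|)e^{\mathrm{i}(l-m)\theta_{\mathbf O_{\mathcal D_L}-\mathbf O_{\mathcal D_{L-1}}}}$$ $$\qquad+\sum_{L_1=2}^{L-1}\sum_{i=1}^{n_{\mathcal D_{L_1}}}\sum_{\mathbf y_j\in\mathcal{DI}_i}\overline R^H_{m,p}\big(k(\mathbf y_j-\mathbf O_{\mathcal D_{L-1}}),k(\mathbf O_{\mathcal D_L}-\mathbf O_{\mathcal D_{L-1}})\big)q_j,$$ where for each $L_1$ the $\mathcal{DI}_i$ are the well separated cells of $\mathcal D_{L_1}$. -/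

import Mathlib

open scoped Nat

noncomputable section

namespace HelmholtzFMM

/-! ## Cylinder functions of integer order (power series), on the positive half line -/

/-- Bessel function `J_n` of order `n ∈ ℕ`. -/
def besselJNat (n : ℕ) (x : ℝ) : ℝ :=
  ∑' k : ℕ, (-1) ^ k / ((k ! : ℝ) * ((n + k)! : ℝ)) * (x / 2) ^ (2 * k + n)

/-- The digamma function at a positive integer: `ψ(k + 1) = 1 + 1/2 + ⋯ + 1/k - γ`. -/
def digammaSucc (k : ℕ) : ℝ := (harmonic k : ℝ) - Real.eulerMascheroniConstant

/-- Neumann function `Y_n` (Bessel function of the second kind) of order `n ∈ ℕ`. -/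
def besselYNat (n : ℕ) (x : ℝ) : ℝ :=
  2 / Real.pi * Real.log (x / 2) * besselJNat n x
    - 1 / Real.pi * ∑ k ∈ Finset.range n,
        ((n - k - 1)! : ℝ) / (k ! : ℝ) * (x / 2) ^ (2 * (k : ℤ) - (n : ℤ))
    - 1 / Real.pi * ∑' k : ℕ, (digammaSucc k + digammaSucc (n + k)) *
        ((-1) ^ k / ((k ! : ℝ) * ((n + k)! : ℝ))) * (x / 2) ^ (2 * k + n)

/-- The factor relating orders `n` and `|n|`: `(-1)^n` for `n < 0`, and `1` for `n ≥ 0`. -/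
def orderSign (n : ℤ) : ℝ := if n < 0 then (-1) ^ n.natAbs else 1

/-- `J_n` for `n ∈ ℤ`, with `J_{-n} = (-1)^n J_n`. -/
def besselJ (n : ℤ) (x : ℝ) : ℝ := orderSign n * besselJNat n.natAbs x

/-- `Y_n` for `n ∈ ℤ`, with `Y_{-n} = (-1)^n Y_n`. -/
def besselY (n : ℤ) (x : ℝ) : ℝ := orderSign n * besselYNat n.natAbs x

/-- The Hankel function `H_n^{(1)} = J_n + i Y_n`. -/
def hankel (n : ℤ) (x : ℝ) : ℂ := (besselJ n x : ℂ) + Complex.I * (besselY n x : ℂ)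

/-- `e^{i n θ_x}`, where `θ_x` is the polar angle of the point `x` of the plane `ℝ² = ℂ`. -/
def phase (n : ℤ) (x : ℂ) : ℂ := Complex.exp (Complex.I * (n : ℂ) * (Complex.arg x : ℂ))

/-! ## Remainders of the truncated Graf addition theorem -/

/-- The general term `H_{m+n}(|x|) e^{i(m+n)θ_x} J_n(|y|) e^{-inθ_y}` of Graf's series. -/
def RHTerm (m : ℤ) (x y : ℂ) (n : ℤ) : ℂ :=
  hankel (m + n) ‖x‖ * phase (m + n) x * (besselJ n ‖y‖ : ℂ) * phase (-n) y

/-- `R^H_{m,p}(x,y)`: the sum of the terms with `n ≥ p + 1` and with `n ≤ -p - 1`. -/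
def RH (m : ℤ) (p : ℕ) (x y : ℂ) : ℂ :=
  (∑' r : ℕ, RHTerm m x y ((p : ℤ) + 1 + (r : ℤ)))
    + ∑' r : ℕ, RHTerm m x y (-(p : ℤ) - 1 - (r : ℤ))

/-- The general term `H_{m+n}(|x|) e^{-i(m+n)θ_x} J_n(|y|) e^{inθ_y}`. -/
def RHbarTerm (m : ℤ) (x y : ℂ) (n : ℤ) : ℂ :=
  hankel (m + n) ‖x‖ * phase (-(m + n)) x * (besselJ n ‖y‖ : ℂ) * phase n y

/-- `\overline{R}^H_{m,p}(x,y)`: the sum of the terms with `n ≥ p - m + 1` and with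
`n ≤ -p - m - 1`. -/
def RHbar (m : ℤ) (p : ℕ) (x y : ℂ) : ℂ :=
  (∑' r : ℕ, RHbarTerm m x y ((p : ℤ) - m + 1 + (r : ℤ)))
    + ∑' r : ℕ, RHbarTerm m x y (-(p : ℤ) - m - 1 - (r : ℤ))

/-! ## Quadtrees -/

/-- The cell of level `level` in column `ix` and row `iy` of the dyadic grid of that level. -/
@[ext]
structure Cell where
  level : ℕ
  ix : ℕ
  iy : ℕ

instance : DecidableEq Cell := Classical.decEq _

namespace Cell

/-- The cell of level `0`. -/
def root : Cell := ⟨0, 0, 0⟩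

/-- The cell of the previous level that contains the given cell. -/
def parent (C : Cell) : Cell := ⟨C.level - 1, C.ix / 2, C.iy / 2⟩

/-- One of the four equal subcells of a cell. -/
def child (C : Cell) (a : Fin 2 × Fin 2) : Cell :=
  ⟨C.level + 1, 2 * C.ix + (a.1 : ℕ), 2 * C.iy + (a.2 : ℕ)⟩

/-- The cell of level `L` that contains the given cell (for `L ≤ D.level`). -/
def ancestor (D : Cell) (L : ℕ) : Cell := parent^[D.level - L] D

end Cell

/-- A finite (uniform or adaptive) quadtree, given by the set of the cells that are divided into
four. Any rule to stop the division is allowed. -/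
structure Quadtree where
  divided : Finset Cell
  reachable : ∀ C ∈ divided, C = Cell.root ∨ ∃ P ∈ divided, ∃ a, C = P.child a

namespace Quadtree

variable (T : Quadtree)

/-- All cells of the tree: the root, and the children of the divided cells. -/
def cells : Finset Cell :=
  insert Cell.root (T.divided.biUnion fun P => Finset.univ.image P.child)

/-- A cell of the tree that has no children. -/
def IsLeaf (C : Cell) : Prop := C ∈ T.cells ∧ C ∉ T.divided

/-- The largest level of a divided cell. -/
def depth : ℕ := T.divided.sup Cell.level

theorem level_le_depth {C : Cell} (h : C ∈ T.divided) : C.level ≤ T.depth :=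
  Finset.le_sup (f := Cell.level) h

end Quadtree

/-- Finitely many field points `y_j` with weights `q_j = φ(y_j) s(y_j)`, a square with lower left
corner `corner` and side length `side` that covers them, and a quadtree over this square. -/
structure Configuration (ι : Type*) where
  y : ι → ℂ
  q : ι → ℂ
  corner : ℂ
  side : ℝ
  side_pos : 0 < side
  covers : ∀ j, (y j).re ∈ Set.Icc corner.re (corner.re + side) ∧
    (y j).im ∈ Set.Icc corner.im (corner.im + side)
  tree : Quadtree

namespace Configuration

variable {ι : Type*} (S : Configuration ι)

/-- The side length of the cells of level `L`. -/
def cellSide (L : ℕ) : ℝ := S.side / 2 ^ L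

/-- The centroid `O_C`. -/
def center (C : Cell) : ℂ :=
  S.corner + (((C.ix + 1 / 2 : ℝ) * S.cellSide C.level : ℝ) : ℂ)
    + (((C.iy + 1 / 2 : ℝ) * S.cellSide C.level : ℝ) : ℂ) * Complex.I

/-- The closed square occupied by a cell. -/
def closedSquare (C : Cell) : Set ℂ :=
  {z | z.re - S.corner.re ∈
          Set.Icc (C.ix * S.cellSide C.level) ((C.ix + 1) * S.cellSide C.level) ∧
       z.im - S.corner.im ∈
          Set.Icc (C.iy * S.cellSide C.level) ((C.iy + 1) * S.cellSide C.level)}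

/-- Two cells are adjacent if their closed squares share at least one point. -/
def Adjacent (C D : Cell) : Prop := (S.closedSquare C ∩ S.closedSquare D).Nonempty

/-- `t` lies in the `i`-th of the `2 ^ L` strips of level `L`; a point on a common edge belongs to
the strip that begins there, so that each point lies in exactly one strip of each level. -/
def InStrip (L i : ℕ) (t : ℝ) : Prop :=
  i * S.cellSide L ≤ t ∧
    (t < (i + 1) * S.cellSide L ∨ (i + 1 = 2 ^ L ∧ t = (i + 1) * S.cellSide L))

variable [Fintype ι]

open Classical in
/-- The indices of the field points `y_j ∈ C`. -/
def points (C : Cell) : Finset ι :=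
  Finset.univ.filter fun j =>
    S.InStrip C.level C.ix ((S.y j).re - S.corner.re) ∧
      S.InStrip C.level C.iy ((S.y j).im - S.corner.im)

open Classical in
/-- The nonempty well separated cells of `D`: they are not adjacent to `D`, and either they are of
the same level and have a parent adjacent to the parent of `D`, or they are leaves of a smaller
level that are adjacent to the parent of `D`. -/
def wellSeparated (D : Cell) : Finset Cell :=
  S.tree.cells.filter fun C =>
    (S.points C).Nonempty ∧ ¬ S.Adjacent C D ∧
      ((C.level = D.level ∧ S.Adjacent C.parent D.parent) ∨
        (C.level < D.level ∧ S.tree.IsLeaf C ∧ S.Adjacent C D.parent))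

/-! ## Moments and their errors, for the wave number `k` and the truncation number `p` -/

/-- The multipole moment `M_n(O_C)`. -/
def multipole (k : ℝ) (C : Cell) (n : ℤ) : ℂ :=
  ∑ j ∈ S.points C, (besselJ n (k * ‖S.y j - S.center C‖) : ℂ)
    * phase (-n) (S.y j - S.center C) * S.q j

open Classical in
/-- The computed multipole moment `\tilde M_n(O_C, p)`: exact for cells without children, and
obtained by the truncated M2M translation from the nonempty children otherwise. -/
def approxMultipole (k : ℝ) (p : ℕ) (C : Cell) (n : ℤ) : ℂ :=
  if _h : C ∈ S.tree.divided then
    ∑ a ∈ Finset.univ.filter (fun a : Fin 2 × Fin 2 => (S.points (C.child a)).Nonempty),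
      ∑ l ∈ Finset.Icc (-(p : ℤ)) (p : ℤ),
        approxMultipole k p (C.child a) l
          * (besselJ (n - l) (k * ‖S.center (C.child a) - S.center C‖) : ℂ)
          * phase (-(n - l)) (S.center (C.child a) - S.center C)
  else S.multipole k C n
termination_by S.tree.depth + 1 - C.level
decreasing_by
  have := S.tree.level_le_depth _h
  simp only [Cell.child]
  omega

/-- The error `EM_n(O_C, p) = M_n(O_C) - \tilde M_n(O_C, p)`. -/
def EM (k : ℝ) (p : ℕ) (C : Cell) (n : ℤ) : ℂ :=
  S.multipole k C n - S.approxMultipole k p C n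

/-- The M2L kernel `H_{n-m}(k|O_D - O_C|) e^{i(n-m)θ_{O_D - O_C}}`. -/
def kerM2L (k : ℝ) (D C : Cell) (m n : ℤ) : ℂ :=
  hankel (n - m) (k * ‖S.center D - S.center C‖) * phase (n - m) (S.center D - S.center C)

/-- The L2L kernel `J_{l-m}(k|O_D - O_P|) e^{i(l-m)θ_{O_D - O_P}}`, with `P` the parent of `D`. -/
def kerL2L (k : ℝ) (D : Cell) (m l : ℤ) : ℂ :=
  (besselJ (l - m) (k * ‖S.center D - S.center D.parent‖) : ℂ)
    * phase (l - m) (S.center D - S.center D.parent)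

/-- The part `LM_m(O_D)` of the exact local moment, by the full M2L translation. -/
def exactLM (k : ℝ) (D : Cell) (m : ℤ) : ℂ :=
  ∑ C ∈ S.wellSeparated D, ∑' n : ℤ, S.multipole k C n * S.kerM2L k D C m n

/-- The exact local moment `L_m(O_D)`: `LM_m(O_D)` at level `2`, and the sum of `LM_m(O_D)` and of
the full L2L translation of the local moments of the parent at the levels `≥ 3`. -/
def exactLocal (k : ℝ) (D : Cell) (m : ℤ) : ℂ :=
  if _h : 3 ≤ D.level then
    S.exactLM k D m + ∑' l : ℤ, exactLocal k D.parent l * S.kerL2L k D m l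
  else S.exactLM k D m
termination_by D.level
decreasing_by
  simp only [Cell.parent]
  omega

/-- The computed M2L translation `\widetilde{LM}_m(O_D, p)`. -/
def approxLM (k : ℝ) (p : ℕ) (D : Cell) (m : ℤ) : ℂ :=
  ∑ C ∈ S.wellSeparated D, ∑ n ∈ Finset.Icc (-(p : ℤ)) (p : ℤ),
    S.approxMultipole k p C n * S.kerM2L k D C m n

/-- The computed local moment `\tilde L_m(O_D, p)`: the M2L translation, and at the levels `≥ 3`
also the truncated L2L translation of the computed local moments of the parent. -/
def approxLocal (k : ℝ) (p : ℕ) (D : Cell) (m : ℤ) : ℂ :=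
  if _h : 3 ≤ D.level then
    S.approxLM k p D m + ∑ l ∈ Finset.Icc (-(p : ℤ)) (p : ℤ),
      approxLocal k p D.parent l * S.kerL2L k D m l
  else S.approxLM k p D m
termination_by D.level
decreasing_by
  simp only [Cell.parent]
  omega

/-- The error `EL_m(O_D, p) = L_m(O_D) - \tilde L_m(O_D, p)`. -/
def EL (k : ℝ) (p : ℕ) (D : Cell) (m : ℤ) : ℂ :=
  S.exactLocal k D m - S.approxLocal k p D m

end Configuration

end HelmholtzFMM

end

open HelmholtzFMM

/-! Everything rests on Graf's addition theorem (`hasSum_RHTerm`): for |y| < |x| the series with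
terms `RHTerm m x y n` converges absolutely to the outgoing wave of order m at x - y. A remainder is
therefore this closed value minus the terms kept (`RH_eq`, `RHbar_eq`). In x - y the intermediate
centre cancels, so the full M2L and L2L translations both reproduce `cellField`, the local moment of
the field points about the new centre. By induction on the level, the exact local moment is the sum
of these over the well separated cells of D and of its ancestors (`exactLocal_eq`). Full minus
truncated translations give the remainders; truncated translations of exact minus computed moments
give the inherited errors.

Graf's theorem is derived from the power series. With z = x/2 and w = conj x/2 taken as independent
variables, ∂/∂z lowers the order of a cylinder wave and ∂/∂w raises it with a minus sign
(`IsLadder`). Replace y by ty with t complex. Both sides become families of holomorphic functions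
indexed by m, and the derivative of the m-th member is the same combination of the members m ± 1 on
either side. They agree at t = 0, so their difference vanishes there to infinite order, and the
identity theorem along [0, 1] reaches t = 1 (`eq_zero_of_linear_system`). The series converges
because n! |x|⁻ⁿ growth of the Hankel waves meets rⁿ/n! decay of the Bessel waves
(`exists_summable_bound`).

The condition |y| < |x| is elementary geometry of squares: `norm_sub_center_lt` for M2L, where the
level gap of at most 2 is used, and `norm_center_sub_center_parent_lt` for L2L. -/

noncomputable section

namespace HelmholtzFMM

/-! ## Power series with factorially decaying coefficients -/

/-- The coefficients are bounded by a multiple of those of the exponential series. -/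
def ExpBounded (c : ℕ → ℂ) (M : ℝ) : Prop := ∀ k, ‖c k‖ ≤ M / (k ! : ℝ)

/-- The sum of a power series. -/
def powSum (c : ℕ → ℂ) (s : ℂ) : ℂ := ∑' k, c k * s ^ k

theorem hasSum_exp_real (r : ℝ) : HasSum (fun k : ℕ => r ^ k / (k ! : ℝ)) (Real.exp r) := by
  rw [Real.exp_eq_exp_ℝ]
  exact NormedSpace.expSeries_div_hasSum_exp r

namespace ExpBounded

variable {c : ℕ → ℂ} {M : ℝ}

theorem norm_term_le (hc : ExpBounded c M) (s : ℂ) (k : ℕ) :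
    ‖c k * s ^ k‖ ≤ M * (‖s‖ ^ k / (k ! : ℝ)) := by
  rw [norm_mul, norm_pow]
  calc ‖c k‖ * ‖s‖ ^ k ≤ M / (k ! : ℝ) * ‖s‖ ^ k := by gcongr; exact hc k
    _ = _ := by ring

theorem summable (hc : ExpBounded c M) (s : ℂ) : Summable fun k => c k * s ^ k :=
  Summable.of_norm_bounded ((hasSum_exp_real ‖s‖).summable.mul_left M) (hc.norm_term_le s)

theorem norm_powSum_le (hc : ExpBounded c M) (s : ℂ) : ‖powSum c s‖ ≤ M * Real.exp ‖s‖ :=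
  tsum_of_norm_bounded ((hasSum_exp_real ‖s‖).mul_left M) (hc.norm_term_le s)

theorem nonneg (hc : ExpBounded c M) : 0 ≤ M := by
  simpa using (norm_nonneg _).trans (hc 0)

theorem shift (hc : ExpBounded c M) : ExpBounded (fun k => c (k + 1)) M := fun k =>
  (hc (k + 1)).trans <| div_le_div_of_nonneg_left hc.nonneg (by positivity)
    (by exact_mod_cast Nat.factorial_le (Nat.le_succ k))

/-- The factor k + 1 is absorbed by (k + 1)!, so differentiation keeps the same M. -/
theorem derivative (hc : ExpBounded c M) : ExpBounded (fun k => ((k : ℂ) + 1) * c (k + 1)) M := by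
  intro k
  have h1 : ‖((k : ℂ) + 1)‖ = (k : ℝ) + 1 := by
    rw [← Nat.cast_succ, Complex.norm_natCast, Nat.cast_succ]
  rw [norm_mul, h1]
  calc ((k : ℝ) + 1) * ‖c (k + 1)‖ ≤ ((k : ℝ) + 1) * (M / ((k + 1)! : ℝ)) := by
        gcongr; exact hc _
    _ = M / (k ! : ℝ) := by
        rw [Nat.factorial_succ]; push_cast
        have : (k ! : ℝ) ≠ 0 := by positivity
        have : (k : ℝ) + 1 ≠ 0 := by positivity
        field_simp

theorem powSum_eq_add (hc : ExpBounded c M) (s : ℂ) :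
    powSum c s = c 0 + s * powSum (fun k => c (k + 1)) s := by
  rw [powSum, (hc.summable s).tsum_eq_zero_add, powSum, ← tsum_mul_left]
  simp only [pow_zero, mul_one]
  congr 1
  exact tsum_congr fun k => by ring

/-- On a ball slightly larger than ‖s‖ an exponential series dominates the terms, so the holomorphic
series may be differentiated termwise. -/
theorem hasDerivAt (hc : ExpBounded c M) (s : ℂ) :
    HasDerivAt (powSum c) (powSum (fun k => ((k : ℂ) + 1) * c (k + 1)) s) s := by
  set R : ℝ := ‖s‖ + 1
  have hs : s ∈ Metric.ball (0 : ℂ) R := by simp [R]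
  have hu := (hasSum_exp_real R).summable.mul_left M
  have hd : ∀ k, DifferentiableOn ℂ (fun s : ℂ => c k * s ^ k) (Metric.ball 0 R) := fun k => by
    fun_prop
  have hb : ∀ (k : ℕ) (w : ℂ), w ∈ Metric.ball (0 : ℂ) R →
      ‖c k * w ^ k‖ ≤ M * (R ^ k / (k ! : ℝ)) := fun k w hw => by
    refine (hc.norm_term_le w k).trans ?_
    have := hc.nonneg
    have : ‖w‖ ≤ R := by simpa using (Metric.mem_ball.mp hw).le
    gcongr
  have h1 := Complex.hasSum_deriv_of_summable_norm hu hd Metric.isOpen_ball hb hs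
  have h2 := ((Complex.differentiableOn_tsum_of_summable_norm hu hd Metric.isOpen_ball hb)
    |>.differentiableAt (Metric.isOpen_ball.mem_nhds hs)).hasDerivAt
  suffices h : powSum (fun k => ((k : ℂ) + 1) * c (k + 1)) s
      = deriv (fun w => ∑' i, c i * w ^ i) s by
    rw [h]; exact h2
  rw [← h1.tsum_eq, h1.summable.tsum_eq_zero_add]
  simp only [pow_zero, mul_one, deriv_const, zero_add, powSum]
  refine tsum_congr fun k => ?_
  rw [deriv_const_mul_field, deriv_pow_field]
  push_cast
  ring

/-- The Euler operator n + s d/ds multiplies the k-th coefficient by n + k; this is what lowers the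
order of a cylinder function. -/
theorem mul_powSum_add (hc : ExpBounded c M) (n : ℕ) (s : ℂ) :
    n * powSum c s + s * powSum (fun k => ((k : ℂ) + 1) * c (k + 1)) s
      = powSum (fun k => ((n : ℂ) + k) * c k) s := by
  have hs : Summable fun k : ℕ => (k : ℂ) * c k * s ^ k := by
    rw [← summable_nat_add_iff 1]
    refine ((hc.derivative.summable s).mul_left s).congr fun k => ?_
    push_cast; ring
  have h : s * powSum (fun k => ((k : ℂ) + 1) * c (k + 1)) s
      = ∑' k : ℕ, (k : ℂ) * c k * s ^ k := by
    rw [hs.tsum_eq_zero_add, powSum, ← tsum_mul_left]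
    simp only [Nat.cast_zero, zero_mul, zero_add]
    exact tsum_congr fun k => by push_cast; ring
  rw [h, powSum, ← tsum_mul_left, powSum, ← ((hc.summable s).mul_left (n : ℂ)).tsum_add hs]
  exact tsum_congr fun k => by ring

end ExpBounded

theorem powSum_add {c d : ℕ → ℂ} {M N : ℝ} (hc : ExpBounded c M) (hd : ExpBounded d N) (s : ℂ) :
    powSum (fun k => c k + d k) s = powSum c s + powSum d s := by
  rw [powSum, powSum, powSum, ← (hc.summable s).tsum_add (hd.summable s)]
  exact tsum_congr fun k => by ring

theorem powSum_neg (c : ℕ → ℂ) (s : ℂ) : powSum (fun k => -c k) s = -powSum c s := by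
  rw [powSum, powSum, ← tsum_neg]
  exact tsum_congr fun k => by ring

/-! ## The entire functions in the series of the cylinder functions -/

/-- Coefficients of the series of `J_n`. -/
def phiCoeff (n k : ℕ) : ℂ := (-1) ^ k / ((k ! : ℂ) * ((n + k)! : ℂ))

/-- Coefficients of the regular part of the series of `Y_n`. -/
def psiCoeff (n k : ℕ) : ℂ := ((digammaSucc k + digammaSucc (n + k) : ℝ) : ℂ) * phiCoeff n k

theorem phiCoeff_expBounded (n : ℕ) : ExpBounded (phiCoeff n) (1 / (n ! : ℝ)) := by
  intro k
  rw [phiCoeff, norm_div, norm_pow, norm_neg, norm_one, one_pow, norm_mul, Complex.norm_natCast,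
    Complex.norm_natCast, div_div, mul_comm]
  have : (n ! : ℝ) ≤ ((n + k)! : ℝ) := by exact_mod_cast Nat.factorial_le (Nat.le_add_right n k)
  gcongr

theorem digammaSucc_succ (k : ℕ) : digammaSucc (k + 1) = digammaSucc k + 1 / ((k : ℝ) + 1) := by
  rw [digammaSucc, digammaSucc, harmonic_succ]
  push_cast
  ring

theorem abs_digammaSucc_le (k : ℕ) : |digammaSucc k| ≤ k + 1 := by
  induction k with
  | zero =>
    have h1 := Real.one_half_lt_eulerMascheroniConstant
    have h2 := Real.eulerMascheroniConstant_lt_two_thirds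
    rw [digammaSucc, harmonic_zero, abs_le]
    constructor <;> norm_num <;> linarith
  | succ k ih =>
    rw [digammaSucc_succ]
    have : |1 / ((k : ℝ) + 1)| ≤ 1 := by
      rw [abs_of_nonneg (by positivity), div_le_one (by positivity)]
      linarith [(Nat.cast_nonneg k : (0 : ℝ) ≤ k)]
    refine (abs_add_le _ _).trans ?_
    push_cast
    linarith

/-- The linear growth of the digamma values is swallowed by (n + k)!. The constant is independent of
n, as `exists_norm_waveH_le` requires. -/
theorem psiCoeff_expBounded (n : ℕ) : ExpBounded (psiCoeff n) 4 := by
  intro k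
  have h1 : |digammaSucc k + digammaSucc (n + k)| ≤ 2 * ((n + k : ℕ) + 1) := by
    refine (abs_add_le _ _).trans ?_
    have := abs_digammaSucc_le k
    have := abs_digammaSucc_le (n + k)
    push_cast at *
    linarith [(Nat.cast_nonneg n : (0 : ℝ) ≤ n)]
  have h2 : (((n + k : ℕ) : ℝ) + 1) ≤ 2 * ((n + k)! : ℝ) := by
    have h3 : n + k ≤ (n + k)! := Nat.self_le_factorial _
    have h4 : 1 ≤ (n + k)! := Nat.factorial_pos _
    have : n + k + 1 ≤ 2 * (n + k)! := by omega
    exact_mod_cast this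
  rw [psiCoeff, norm_mul, Complex.norm_real, Real.norm_eq_abs, phiCoeff, norm_div, norm_pow,
    norm_neg, norm_one, one_pow, norm_mul, Complex.norm_natCast, Complex.norm_natCast]
  calc _ ≤ (2 * (2 * ((n + k)! : ℝ))) * (1 / ((k ! : ℝ) * ((n + k)! : ℝ))) := by
        gcongr; linarith
    _ = 4 / (k ! : ℝ) := by
        have : ((n + k)! : ℝ) ≠ 0 := by positivity
        have : (k ! : ℝ) ≠ 0 := by positivity
        field_simp; norm_num

theorem succ_mul_phiCoeff_succ (n k : ℕ) :
    ((k : ℂ) + 1) * phiCoeff n (k + 1) = -phiCoeff (n + 1) k := by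
  rw [phiCoeff, phiCoeff, show n + (k + 1) = n + 1 + k by ring, Nat.factorial_succ k]
  have h1 : ((n + 1 + k)! : ℂ) ≠ 0 := by exact_mod_cast Nat.factorial_ne_zero _
  have h2 : (k ! : ℂ) ≠ 0 := by exact_mod_cast Nat.factorial_ne_zero _
  have h3 : (k : ℂ) + 1 ≠ 0 := by exact_mod_cast Nat.succ_ne_zero k
  push_cast
  field_simp
  ring

theorem add_mul_phiCoeff_succ (n k : ℕ) :
    (((n + 1 : ℕ) : ℂ) + k) * phiCoeff (n + 1) k = phiCoeff n k := by
  rw [phiCoeff, phiCoeff, show n + 1 + k = (n + k) + 1 by ring, Nat.factorial_succ (n + k)]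
  have h1 : ((n + k)! : ℂ) ≠ 0 := by exact_mod_cast Nat.factorial_ne_zero _
  have h2 : (k ! : ℂ) ≠ 0 := by exact_mod_cast Nat.factorial_ne_zero _
  have h3 : (n : ℂ) + k + 1 ≠ 0 := by exact_mod_cast Nat.succ_ne_zero (n + k)
  have h4 : (n : ℂ) + 1 + k ≠ 0 := by rwa [add_right_comm]
  push_cast
  field_simp
  ring

/-- `J_n(x) = (x/2)^n φ_n(x²/4)`. -/
def phi (n : ℕ) : ℂ → ℂ := powSum (phiCoeff n)

/-- The regular part of `Y_n`. -/
def psi (n : ℕ) : ℂ → ℂ := powSum (psiCoeff n)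

/-- The singular part of `Y_n`. -/
def sing (n : ℕ) (s : ℂ) : ℂ := ∑ k ∈ Finset.range n, ((n - k - 1)! : ℂ) / (k ! : ℂ) * s ^ k

/-- The derivative of `sing`. -/
def singDeriv (n : ℕ) (s : ℂ) : ℂ :=
  ∑ k ∈ Finset.range n, ((n - k - 1)! : ℂ) / (k ! : ℂ) * (k * s ^ (k - 1))

/-- The derivative of `psi`. -/
def psiDeriv (n : ℕ) : ℂ → ℂ := powSum fun k => ((k : ℂ) + 1) * psiCoeff n (k + 1)

theorem hasDerivAt_phi (n : ℕ) (s : ℂ) : HasDerivAt (phi n) (-phi (n + 1) s) s := by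
  have := (phiCoeff_expBounded n).hasDerivAt s
  simp_rw [succ_mul_phiCoeff_succ, powSum_neg] at this
  exact this

theorem hasDerivAt_psi (n : ℕ) (s : ℂ) : HasDerivAt (psi n) (psiDeriv n s) s :=
  (psiCoeff_expBounded n).hasDerivAt s

theorem hasDerivAt_sing (n : ℕ) (s : ℂ) : HasDerivAt (sing n) (singDeriv n s) s := by
  unfold sing singDeriv
  exact HasDerivAt.fun_sum fun k _ => (hasDerivAt_pow k s).const_mul _

/-- This is the three-term recurrence of the Bessel functions with the powers of x/2 removed. -/
theorem phi_recurrence (n : ℕ) (s : ℂ) :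
    ((n : ℂ) + 1) * phi (n + 1) s - s * phi (n + 2) s = phi n s := by
  have := (phiCoeff_expBounded (n + 1)).mul_powSum_add (n + 1) s
  simp_rw [succ_mul_phiCoeff_succ, powSum_neg, add_mul_phiCoeff_succ] at this
  rw [phi, phi, phi, ← this]
  push_cast
  ring

/-- The extra `phi (n + 1)` comes from the increment 1/(n + k + 1) of the digamma function; it will
cancel the z-derivative of the logarithm. -/
theorem psi_recurrence (n : ℕ) (s : ℂ) :
    ((n : ℂ) + 1) * psi (n + 1) s + s * psiDeriv (n + 1) s = psi n s + phi (n + 1) s := by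
  have := (psiCoeff_expBounded (n + 1)).mul_powSum_add (n + 1) s
  rw [psiDeriv, psi, psi, phi, ← powSum_add (psiCoeff_expBounded n) (phiCoeff_expBounded (n + 1))]
  push_cast at this
  rw [this]
  congr 1
  ext k
  have h := add_mul_phiCoeff_succ n k
  push_cast at h
  have h3 : (n : ℂ) + k + 1 ≠ 0 := by exact_mod_cast Nat.succ_ne_zero (n + k)
  rw [psiCoeff, psiCoeff, mul_left_comm, h, ← h, show n + 1 + k = (n + k) + 1 by ring,
    digammaSucc_succ]
  push_cast
  field_simp
  ring

/-- Needed for the w-derivative, where `phi n` comes from the logarithm. The leftover 1/n! cancels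
the last term of `sing_recurrence`. -/
theorem phi_sub_mul_psiDeriv (n : ℕ) (s : ℂ) :
    phi n s - s * psiDeriv n s = 1 / (n ! : ℂ) + s * psi (n + 1) s := by
  have h : psi (n + 1) s = powSum (fun k => phiCoeff n (k + 1)) s - psiDeriv n s := by
    rw [sub_eq_add_neg, psiDeriv, ← powSum_neg, psi,
      ← powSum_add (phiCoeff_expBounded n).shift (N := 4)]
    · congr 1
      ext k
      rw [psiCoeff, psiCoeff, mul_left_comm, succ_mul_phiCoeff_succ,
        eq_div_of_mul_eq (by exact_mod_cast Nat.succ_ne_zero k)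
          ((mul_comm _ _).trans (succ_mul_phiCoeff_succ n k)), digammaSucc_succ,
        show n + (k + 1) = n + 1 + k by ring]
      push_cast
      ring
    · intro k
      rw [norm_neg]
      exact (psiCoeff_expBounded n).derivative k
  rw [h, phi, (phiCoeff_expBounded n).powSum_eq_add s]
  simp [phiCoeff]
  ring

theorem singDeriv_succ (n : ℕ) (s : ℂ) : singDeriv (n + 1) s = sing n s := by
  rw [singDeriv, sing, Finset.sum_range_succ']
  simp only [Nat.cast_zero, zero_mul, mul_zero, add_zero]
  refine Finset.sum_congr rfl fun k _ => ?_
  have h3 : (k : ℂ) + 1 ≠ 0 := by exact_mod_cast Nat.succ_ne_zero k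
  have h2 : (k ! : ℂ) ≠ 0 := by exact_mod_cast Nat.factorial_ne_zero _
  rw [show n + 1 - (k + 1) - 1 = n - k - 1 by omega, Nat.factorial_succ]
  push_cast
  field_simp

theorem sing_recurrence (n : ℕ) (s : ℂ) :
    n * sing n s - s * singDeriv n s = sing (n + 1) s - s ^ n / (n ! : ℂ) := by
  rw [sing, singDeriv, sing, Finset.sum_range_succ, Finset.mul_sum, Finset.mul_sum,
    ← Finset.sum_sub_distrib]
  have hl : (((n + 1 - n - 1)! : ℕ) : ℂ) = 1 := by
    rw [show n + 1 - n - 1 = 0 by omega]; simp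
  rw [hl, eq_sub_iff_add_eq, one_div_mul_eq_div]
  congr 1
  refine Finset.sum_congr rfl fun k hk => ?_
  have hk := Finset.mem_range.mp hk
  obtain ⟨d, rfl⟩ : ∃ d, n = k + d + 1 := ⟨n - k - 1, by omega⟩
  rw [show k + d + 1 - k - 1 = d by omega, show k + d + 1 + 1 - k - 1 = d + 1 by omega,
    Nat.factorial_succ d]
  rcases k with _ | k
  · simp
  · simp only [Nat.add_sub_cancel]
    push_cast
    ring

/-! ## Cylinder waves as functions of two complex variables -/

/-- `J_n(|x|) e^{inθ_x}` for `n ≥ 0`, as a function of `z = x / 2` and `w = conj x / 2`. -/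
def waveJ (n : ℕ) (z w : ℂ) : ℂ := z ^ n * phi n (z * w)

/-- `π Y_n(|x|) e^{inθ_x}` for `n ≥ 0`, as a function of `z = x / 2` and `w = conj x / 2`. -/
def waveY (n : ℕ) (z w : ℂ) : ℂ :=
  Complex.log (z * w) * waveJ n z w - (w ^ n)⁻¹ * sing n (z * w) - z ^ n * psi n (z * w)

/-- `H_n(|x|) e^{inθ_x}` for `n ≥ 0`, as a function of `z = x / 2` and `w = conj x / 2`. -/
def waveH (n : ℕ) (z w : ℂ) : ℂ := waveJ n z w + Complex.I / Real.pi * waveY n z w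

/-- Extension of a family of waves to negative orders. -/
def extend (F : ℕ → ℂ → ℂ → ℂ) (n : ℤ) (z w : ℂ) : ℂ :=
  if n < 0 then (-1) ^ n.natAbs * F n.natAbs w z else F n.natAbs z w

theorem extend_natCast (F : ℕ → ℂ → ℂ → ℂ) (n : ℕ) (z w : ℂ) : extend F n z w = F n z w := by
  rw [extend, if_neg (by omega), Int.natAbs_natCast]

theorem extend_neg_succ (F : ℕ → ℂ → ℂ → ℂ) (n : ℕ) (z w : ℂ) :
    extend F (-((n : ℤ) + 1)) z w = (-1) ^ (n + 1) * F (n + 1) w z := by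
  rw [extend, if_pos (by omega), show (-((n : ℤ) + 1)).natAbs = n + 1 by omega]

/-- The differentiation formulas of cylinder waves: the two Wirtinger derivatives lower and raise
the order. -/
structure IsLadder (F : ℕ → ℂ → ℂ → ℂ) (Ω : Set ℂ) : Prop where
  symm : ∀ z w, z * w ∈ Ω → F 0 z w = F 0 w z
  zero : ∀ (z w : ℂ → ℂ) (b d t : ℂ), z t * w t ∈ Ω → HasDerivAt z b t → HasDerivAt w d t →
    HasDerivAt (fun t => F 0 (z t) (w t)) (-b * F 1 (w t) (z t) - d * F 1 (z t) (w t)) t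
  succ : ∀ (n : ℕ) (z w : ℂ → ℂ) (b d t : ℂ), z t * w t ∈ Ω → HasDerivAt z b t →
    HasDerivAt w d t →
    HasDerivAt (fun t => F (n + 1) (z t) (w t))
      (b * F n (z t) (w t) - d * F (n + 2) (z t) (w t)) t

/-- A negative order exchanges z and w, hence the two derivatives, and the sign (-1)ⁿ restores the
form of the rule. Orders 0 and -1, where the two definitions meet, need `zero` and `symm`. -/
theorem IsLadder.hasDerivAt_extend {F : ℕ → ℂ → ℂ → ℂ} {Ω : Set ℂ} (hF : IsLadder F Ω) (n : ℤ)
    {z w : ℂ → ℂ} {b d t : ℂ} (hΩ : z t * w t ∈ Ω) (hz : HasDerivAt z b t)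
    (hw : HasDerivAt w d t) :
    HasDerivAt (fun t => extend F n (z t) (w t))
      (b * extend F (n - 1) (z t) (w t) - d * extend F (n + 1) (z t) (w t)) t := by
  have hΩ' : w t * z t ∈ Ω := by rwa [mul_comm]
  rcases n with n | n
  · simp only [Int.ofNat_eq_natCast, extend_natCast]
    rcases n with _ | n
    · have h1 := extend_neg_succ F 0
      have h2 := extend_natCast F 1
      norm_num at h1 h2 ⊢
      rw [h1, h2]
      refine HasDerivAt.congr_deriv (hF.zero z w b d t hΩ hz hw) ?_
      ring
    · have h1 := extend_natCast F n
      have h2 := extend_natCast F (n + 2)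
      push_cast at h2
      rw [show ((n + 1 : ℕ) : ℤ) - 1 = n by omega, show ((n + 1 : ℕ) : ℤ) + 1 = n + 2 by omega,
        h1, h2]
      exact hF.succ n z w b d t hΩ hz hw
  · have h0 := extend_neg_succ F n
    have h1 := extend_neg_succ F (n + 1)
    push_cast at h1
    rw [show Int.negSucc n = -((n : ℤ) + 1) by omega,
      show -((n : ℤ) + 1) - 1 = -((n : ℤ) + 1 + 1) by omega, h1]
    simp_rw [h0]
    have h3 : extend F (-((n : ℤ) + 1) + 1) (z t) (w t) = (-1) ^ n * F n (w t) (z t) := by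
      rcases n with _ | n
      · have := extend_natCast F 0
        norm_num at this ⊢
        rw [this, hF.symm _ _ hΩ]
      · have := extend_neg_succ F n
        rw [show -(((n + 1 : ℕ) : ℤ) + 1) + 1 = -((n : ℤ) + 1) by omega, this]
    rw [h3]
    refine HasDerivAt.congr_deriv ((hF.succ n w z d b t hΩ' hw hz).const_mul ((-1) ^ (n + 1))) ?_
    ring

theorem isLadder_waveJ : IsLadder waveJ Set.univ where
  symm z w _ := by simp [waveJ, mul_comm]
  zero z w b d t _ hz hw := by
    simp only [waveJ, pow_zero, one_mul, pow_one]
    refine HasDerivAt.congr_deriv ((hasDerivAt_phi 0 (z t * w t)).comp t (hz.mul hw)) ?_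
    rw [mul_comm (w t) (z t)]
    ring
  succ n z w b d t _ hz hw := by
    simp only [waveJ]
    refine HasDerivAt.congr_deriv ((hz.pow (n + 1)).mul
      ((hasDerivAt_phi (n + 1) (z t * w t)).comp t
      (hz.mul hw))) ?_
    simp only [← phi_recurrence n (z t * w t), Pi.pow_apply]
    push_cast
    ring

/-- Only the product z w enters the logarithm, so the cut is harmless for conjugate nonzero z and w,
where z w > 0. -/
theorem isLadder_waveY : IsLadder waveY Complex.slitPlane where
  symm z w _ := by simp [waveY, waveJ, mul_comm]
  zero z w b d t hΩ hz hw := by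
    have hzw := Complex.slitPlane_ne_zero hΩ
    have hz0 := left_ne_zero_of_mul hzw
    have hw0 := right_ne_zero_of_mul hzw
    have hs := hz.mul hw
    have h1 := ((hs.clog hΩ).mul (isLadder_waveJ.zero z w b d t trivial hz hw)).sub
      ((hasDerivAt_psi 0 (z t * w t)).comp t hs)
    simp only [waveY, pow_zero, one_mul, pow_one, inv_one]
    have hsing : ∀ s, sing 0 s = 0 := fun s => by simp [sing]
    have hsing1 : ∀ s, sing 1 s = 1 := fun s => by simp [sing]
    simp only [hsing, hsing1, sub_zero, mul_one]
    refine HasDerivAt.congr_deriv (h1) ?_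
    have h2 := phi_sub_mul_psiDeriv 0 (z t * w t)
    have h3 : psi 1 (z t * w t)
        = (phi 0 (z t * w t) - z t * w t * psiDeriv 0 (z t * w t) - 1) / (z t * w t) := by
      rw [eq_div_iff hzw]
      simp only [Nat.factorial_zero, Nat.cast_one, div_one, zero_add] at h2
      linear_combination -h2
    simp only [waveJ, Pi.mul_apply, pow_zero, one_mul, pow_one]
    rw [mul_comm (w t) (z t), h3]
    field_simp
    ring
  succ n z w b d t hΩ hz hw := by
    have hzw := Complex.slitPlane_ne_zero hΩ
    have hz0 := left_ne_zero_of_mul hzw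
    have hw0 := right_ne_zero_of_mul hzw
    have hs := hz.mul hw
    have h1 := (((hs.clog hΩ).mul (isLadder_waveJ.succ n z w b d t trivial hz hw)).sub
      (((hw.pow (n + 1)).inv (pow_ne_zero _ hw0)).mul
        ((hasDerivAt_sing (n + 1) (z t * w t)).comp t hs))).sub
      ((hz.pow (n + 1)).mul ((hasDerivAt_psi (n + 1) (z t * w t)).comp t hs))
    simp only [waveY]
    refine HasDerivAt.congr_deriv (h1) ?_
    -- Eliminate `psi (n + 2)`, `psi n` and `sing (n + 2)` by the recurrences; a rational identity
    -- remains.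
    have h2 := phi_sub_mul_psiDeriv (n + 1) (z t * w t)
    have h3 : psi (n + 2) (z t * w t)
        = (phi (n + 1) (z t * w t) - z t * w t * psiDeriv (n + 1) (z t * w t)
          - 1 / ((n + 1)! : ℂ)) / (z t * w t) := by
      rw [eq_div_iff hzw]
      linear_combination -h2
    have h4 : psi n (z t * w t) = _ := eq_sub_of_add_eq (psi_recurrence n (z t * w t)).symm
    have h5 := sing_recurrence (n + 1) (z t * w t)
    have h6 : sing (n + 2) (z t * w t) = _ := eq_add_of_sub_eq h5.symm
    rw [singDeriv_succ] at h6
    have hf : ((n + 1)! : ℂ) ≠ 0 := by exact_mod_cast Nat.factorial_ne_zero _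
    simp only [waveJ, Pi.mul_apply, Pi.pow_apply, Pi.inv_apply, Function.comp]
    rw [h3, h4, h6, singDeriv_succ, mul_pow]
    push_cast
    have hw1 := pow_ne_zero n hw0
    simp only [pow_succ]
    field_simp
    ring

theorem isLadder_waveH : IsLadder waveH Complex.slitPlane where
  symm z w h := by rw [waveH, waveH, isLadder_waveJ.symm z w trivial, isLadder_waveY.symm z w h]
  zero z w b d t hΩ hz hw := by
    simp only [waveH]
    refine HasDerivAt.congr_deriv ((isLadder_waveJ.zero z w b d t trivial hz hw).add
      ((isLadder_waveY.zero z w b d t hΩ hz hw).const_mul (Complex.I / Real.pi))) ?_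
    ring
  succ n z w b d t hΩ hz hw := by
    simp only [waveH]
    refine HasDerivAt.congr_deriv ((isLadder_waveJ.succ n z w b d t trivial hz hw).add
      ((isLadder_waveY.succ n z w b d t hΩ hz hw).const_mul (Complex.I / Real.pi))) ?_
    ring

/-! ## Bounds -/

theorem norm_waveJ_le (n : ℕ) (z w : ℂ) :
    ‖waveJ n z w‖ ≤ ‖z‖ ^ n / (n ! : ℝ) * Real.exp (‖z‖ * ‖w‖) := by
  rw [waveJ, norm_mul, norm_pow, ← norm_mul z w]
  calc _ ≤ ‖z‖ ^ n * (1 / (n ! : ℝ) * Real.exp ‖z * w‖) := by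
        gcongr; exact (phiCoeff_expBounded n).norm_powSum_le _
    _ = _ := by ring

theorem norm_sing_le (n : ℕ) (s : ℂ) : ‖sing n s‖ ≤ (n ! : ℝ) * Real.exp ‖s‖ := by
  calc ‖sing n s‖ ≤ ∑ k ∈ Finset.range n, (n ! : ℝ) * (‖s‖ ^ k / (k ! : ℝ)) := by
        refine norm_sum_le_of_le _ fun k _ => ?_
        rw [norm_mul, norm_div, norm_pow, Complex.norm_natCast, Complex.norm_natCast,
          div_mul_eq_mul_div, mul_div_assoc]
        gcongr
        omega
    _ = (n ! : ℝ) * ∑ k ∈ Finset.range n, ‖s‖ ^ k / (k ! : ℝ) := by rw [Finset.mul_sum]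
    _ ≤ _ := by
        gcongr
        exact Real.sum_le_exp_of_nonneg (norm_nonneg s) n

/-- The singular part sets the growth. The regular parts carry ‖z‖ⁿ, which is no larger up to a
constant, since (‖z‖‖w‖)ⁿ/n! is one term of an exponential series. -/
theorem exists_norm_waveH_le {z w : ℂ} (hw : w ≠ 0) :
    ∃ K, 0 ≤ K ∧ ∀ n : ℕ, ‖waveH n z w‖ ≤ K * ((n ! : ℝ) * (‖w‖⁻¹) ^ n) := by
  set E := Real.exp (‖z‖ * ‖w‖) with hE
  have hw' : 0 < ‖w‖ := norm_pos_iff.mpr hw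
  have hE1 : 0 < E := Real.exp_pos _
  have key : ∀ n : ℕ, ‖z‖ ^ n ≤ E * ((n ! : ℝ) * (‖w‖⁻¹) ^ n) := fun n => by
    have h := Real.pow_div_factorial_le_exp (‖z‖ * ‖w‖) (by positivity) n
    rw [div_le_iff₀ (by positivity), mul_pow, ← le_div_iff₀ (by positivity)] at h
    refine h.trans_eq ?_
    rw [inv_pow, div_eq_mul_inv, mul_assoc]
  have keyJ : ∀ n : ℕ, ‖waveJ n z w‖ ≤ E * (E * ((n ! : ℝ) * (‖w‖⁻¹) ^ n)) := fun n => by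
    refine (norm_waveJ_le n z w).trans ?_
    rw [mul_comm]
    refine mul_le_mul_of_nonneg_left (le_trans ?_ (key n)) hE1.le
    exact div_le_self (by positivity) (by exact_mod_cast Nat.factorial_pos n)
  set l := ‖Complex.log (z * w)‖
  set c := ‖Complex.I / (Real.pi : ℂ)‖
  refine ⟨E * E + c * (l * (E * E) + E + E * (4 * E)), by positivity, fun n => ?_⟩
  have hY : ‖waveY n z w‖ ≤ l * (E * (E * ((n ! : ℝ) * (‖w‖⁻¹) ^ n)))
      + (‖w‖⁻¹) ^ n * ((n ! : ℝ) * E) + E * ((n ! : ℝ) * (‖w‖⁻¹) ^ n) * (4 * E) := by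
    refine (norm_sub_le _ _).trans (add_le_add ((norm_sub_le _ _).trans (add_le_add ?_ ?_)) ?_)
    · rw [norm_mul]
      exact mul_le_mul_of_nonneg_left (keyJ n) (norm_nonneg _)
    · rw [norm_mul, norm_inv, norm_pow, inv_pow]
      gcongr
      rw [hE, ← norm_mul]
      exact norm_sing_le n _
    · rw [norm_mul, norm_pow]
      gcongr
      · exact key n
      · rw [hE, ← norm_mul]
        exact (psiCoeff_expBounded n).norm_powSum_le _
  calc ‖waveH n z w‖ ≤ ‖waveJ n z w‖ + c * ‖waveY n z w‖ := by
        rw [waveH]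
        refine (norm_add_le _ _).trans ?_
        rw [norm_mul]
    _ ≤ E * (E * ((n ! : ℝ) * (‖w‖⁻¹) ^ n)) + c * (l * (E * (E * ((n ! : ℝ) * (‖w‖⁻¹) ^ n)))
      + (‖w‖⁻¹) ^ n * ((n ! : ℝ) * E) + E * ((n ! : ℝ) * (‖w‖⁻¹) ^ n) * (4 * E)) := by
        gcongr
        exact keyJ n
    _ = _ := by ring

open ComplexConjugate

theorem norm_extend_le {F : ℕ → ℂ → ℂ → ℂ} {z w : ℂ} {B : ℕ → ℝ} (h1 : ∀ n, ‖F n z w‖ ≤ B n)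
    (h2 : ∀ n, ‖F n w z‖ ≤ B n) (n : ℤ) : ‖extend F n z w‖ ≤ B n.natAbs := by
  rw [extend]
  split_ifs
  · rw [norm_mul, norm_pow, norm_neg, norm_one, one_pow, one_mul]
    exact h2 _
  · exact h1 _

/-- Translating the order changes the growth of `n! cⁿ` by a polynomial factor only. -/
theorem exists_factorial_mul_pow_shift_le {c : ℝ} (hc : 0 < c) (m : ℤ) :
    ∃ (K : ℝ) (d : ℕ), 0 ≤ K ∧ ∀ n : ℤ,
      ((m + n).natAbs ! : ℝ) * c ^ (m + n).natAbs
        ≤ K * ((n.natAbs : ℝ) + 1) ^ d * ((n.natAbs ! : ℝ) * c ^ n.natAbs) := by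
  -- The constant c + c⁻¹ dominates both c and c⁻¹, so it serves for raising and for lowering N.
  have up : ∀ N : ℕ, ((N + 1)! : ℝ) * c ^ (N + 1) ≤
      (c + c⁻¹) * ((N : ℝ) + 1) * ((N ! : ℝ) * c ^ N) := fun N => by
    rw [Nat.factorial_succ, pow_succ]
    push_cast
    have : 0 ≤ c⁻¹ * ((N : ℝ) + 1) * ((N ! : ℝ) * c ^ N) := by positivity
    linarith
  have down : ∀ N : ℕ, (N ! : ℝ) * c ^ N ≤
      (c + c⁻¹) * (((N + 1 : ℕ) : ℝ) + 1) * (((N + 1)! : ℝ) * c ^ (N + 1)) := fun N => by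
    have h1 : (1 : ℝ) ≤ (((N + 1 : ℕ) : ℝ) + 1) * ((N : ℝ) + 1) := by
      push_cast
      nlinarith [(Nat.cast_nonneg N : (0 : ℝ) ≤ N)]
    calc (N ! : ℝ) * c ^ N ≤ (((N + 1 : ℕ) : ℝ) + 1) * ((N : ℝ) + 1) * ((N ! : ℝ) * c ^ N) :=
          le_mul_of_one_le_left (by positivity) h1
      _ = c⁻¹ * (((N + 1 : ℕ) : ℝ) + 1) * (((N + 1)! : ℝ) * c ^ (N + 1)) := by
          rw [Nat.factorial_succ, pow_succ]
          push_cast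
          field_simp
      _ ≤ _ := by gcongr; linarith
  have step : ∀ (n e : ℤ), e = 1 ∨ e = -1 → ((e + n).natAbs ! : ℝ) * c ^ (e + n).natAbs ≤
      (c + c⁻¹) * ((n.natAbs : ℝ) + 1) * ((n.natAbs ! : ℝ) * c ^ n.natAbs) := fun n e he => by
    have : (e + n).natAbs = n.natAbs + 1 ∨ n.natAbs = (e + n).natAbs + 1 := by omega
    rcases this with h | h
    · rw [h]; exact up _
    · rw [h]; exact down _
  have one_step : ∀ (m e : ℤ), e = 1 ∨ e = -1 →
      (∃ (K : ℝ) (d : ℕ), 0 ≤ K ∧ ∀ n : ℤ,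
        ((m + n).natAbs ! : ℝ) * c ^ (m + n).natAbs
          ≤ K * ((n.natAbs : ℝ) + 1) ^ d * ((n.natAbs ! : ℝ) * c ^ n.natAbs)) →
      (∃ (K : ℝ) (d : ℕ), 0 ≤ K ∧ ∀ n : ℤ,
        ((m + e + n).natAbs ! : ℝ) * c ^ (m + e + n).natAbs
          ≤ K * ((n.natAbs : ℝ) + 1) ^ d * ((n.natAbs ! : ℝ) * c ^ n.natAbs)) := by
    rintro m e he ⟨K, d, hK, h⟩
    refine ⟨K * 2 ^ d * (c + c⁻¹), d + 1, by positivity, fun n => ?_⟩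
    have h1 : (((e + n).natAbs : ℝ) + 1) ≤ 2 * ((n.natAbs : ℝ) + 1) := by
      have : (e + n).natAbs + 1 ≤ 2 * (n.natAbs + 1) := by omega
      exact_mod_cast this
    rw [add_assoc]
    calc _ ≤ _ := h (e + n)
      _ ≤ K * (2 * ((n.natAbs : ℝ) + 1)) ^ d *
          ((c + c⁻¹) * ((n.natAbs : ℝ) + 1) * ((n.natAbs ! : ℝ) * c ^ n.natAbs)) := by
          gcongr ?_ * ?_
          · gcongr
          · exact step n e he
      _ = _ := by rw [mul_pow]; ring
  induction m with
  | zero => exact ⟨1, 0, zero_le_one, fun n => by simp⟩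
  | succ i ih => exact one_step _ 1 (Or.inl rfl) ih
  | pred i ih => exact one_step _ (-1) (Or.inr rfl) ih

theorem summable_int_natAbs {f : ℕ → ℝ} (hf : Summable f) :
    Summable fun n : ℤ => f n.natAbs := by
  refine Summable.of_nat_of_neg ?_ ?_ <;> simpa using hf

/-- The factorials cancel up to a polynomial in |n|, leaving a geometric series of ratio c r. -/
theorem summable_factorial_shift {c r : ℝ} (hc : 0 < c) (hr : 0 < r) (hcr : c * r < 1) (m : ℤ) :
    Summable fun n : ℤ => (((m + n).natAbs ! : ℝ) * c ^ (m + n).natAbs) *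
      (r ^ n.natAbs / (n.natAbs ! : ℝ)) := by
  obtain ⟨K, d, hK, h⟩ := exists_factorial_mul_pow_shift_le hc m
  have hq : 0 < c * r := by positivity
  have hs : Summable fun N : ℕ => ((N : ℝ) + 1) ^ d * (c * r) ^ N := by
    have h1 := summable_pow_mul_geometric_of_norm_lt_one (R := ℝ) d (r := c * r)
      (by rwa [Real.norm_of_nonneg hq.le])
    have h2 := ((summable_nat_add_iff 1).mpr h1).mul_left (c * r)⁻¹
    refine h2.congr fun N => ?_
    push_cast
    rw [pow_succ]
    field_simp
  refine Summable.of_nonneg_of_le (fun n => by positivity) (fun n => ?_)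
    ((summable_int_natAbs hs).mul_left K)
  calc _ ≤ K * ((n.natAbs : ℝ) + 1) ^ d * ((n.natAbs ! : ℝ) * c ^ n.natAbs) *
        (r ^ n.natAbs / (n.natAbs ! : ℝ)) := by
        gcongr ?_ * _
        exact h n
    _ = _ := by
        rw [mul_pow]
        field_simp

theorem norm_extend_waveJ_le {z w : ℂ} {r : ℝ} (hz : ‖z‖ ≤ r) (hw : ‖w‖ ≤ r) (n : ℤ) :
    ‖extend waveJ n z w‖ ≤ r ^ n.natAbs / (n.natAbs ! : ℝ) * Real.exp (r * r) := by
  have hr : 0 ≤ r := (norm_nonneg z).trans hz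
  refine norm_extend_le (B := fun n => r ^ n / (n ! : ℝ) * Real.exp (r * r))
    (fun n => ?_) (fun n => ?_) n
  · exact (norm_waveJ_le n z w).trans (by gcongr)
  · exact (norm_waveJ_le n w z).trans (by gcongr)

/-- A summable bound, uniform in the argument of the Bessel functions, for Graf's series. -/
theorem exists_summable_bound {x : ℂ} {r : ℝ} (hr : 0 < r) (hrx : r < ‖x‖) (m : ℤ) :
    ∃ u : ℤ → ℝ, Summable u ∧ ∀ (n : ℤ) (z w : ℂ), ‖z‖ ≤ r → ‖w‖ ≤ r →
      ‖extend waveH (m + n) x (conj x) * extend waveJ n z w‖ ≤ u n := by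
  have hx : x ≠ 0 := norm_pos_iff.mp (hr.trans hrx)
  obtain ⟨K₁, hK₁, h₁⟩ := exists_norm_waveH_le (z := x) (w := conj x) (by simpa using hx)
  obtain ⟨K₂, hK₂, h₂⟩ := exists_norm_waveH_le (z := conj x) (w := x) hx
  rw [RCLike.norm_conj] at h₁
  have hH : ∀ n : ℤ, ‖extend waveH n x (conj x)‖
      ≤ (K₁ + K₂) * ((n.natAbs ! : ℝ) * ‖x‖⁻¹ ^ n.natAbs) := by
    refine norm_extend_le (B := fun n => (K₁ + K₂) * ((n ! : ℝ) * ‖x‖⁻¹ ^ n)) (fun n => ?_)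
      (fun n => ?_)
    · exact (h₁ n).trans (by gcongr; linarith)
    · exact (h₂ n).trans (by gcongr; linarith)
  have hs := summable_factorial_shift (c := ‖x‖⁻¹) (r := r) (by positivity) hr
    (by rwa [inv_mul_lt_one₀ (hr.trans hrx)]) m
  refine ⟨_, (hs.mul_left ((K₁ + K₂) * Real.exp (r * r))), fun n z w hz hw => ?_⟩
  rw [norm_mul]
  calc _ ≤ ((K₁ + K₂) * (((m + n).natAbs ! : ℝ) * ‖x‖⁻¹ ^ (m + n).natAbs)) *
        (r ^ n.natAbs / (n.natAbs ! : ℝ) * Real.exp (r * r)) := by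
        gcongr
        · exact hH _
        · exact norm_extend_waveJ_le hz hw n
    _ = _ := by ring

/-! ### Graf's addition theorem from a linear system of differential equations -/

/-- A family of holomorphic functions that satisfies a homogeneous linear system of differential
equations, infinite in both directions, and vanishes at a point, vanishes identically. -/
theorem eq_zero_of_linear_system {V S : Set ℂ} (hV : IsOpen V) (hSV : S ⊆ V)
    (hS : IsPreconnected S) {t₀ : ℂ} (h₀ : t₀ ∈ S) {h : ℤ → ℂ → ℂ} {α β : ℂ}
    (hd : ∀ m, ∀ t ∈ V, HasDerivAt (h m) (α * h (m + 1) t + β * h (m - 1) t) t)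
    (hz : ∀ m, h m t₀ = 0) (m : ℤ) {t : ℂ} (ht : t ∈ S) : h m t = 0 := by
  have han : ∀ m, AnalyticOnNhd ℂ (h m) V := fun m =>
    DifferentiableOn.analyticOnNhd
      (fun t ht => (hd m t ht).differentiableAt.differentiableWithinAt) hV
  have ht₀ : V ∈ nhds t₀ := hV.mem_nhds (hSV h₀)
  -- Induct on N for all m at once: if every member vanishes to order N at t₀, so does every
  -- derivative, and every member then vanishes to order N + 1.
  have hord : ∀ (N : ℕ) (m : ℤ), (N : ℕ∞) ≤ analyticOrderAt (h m) t₀ := by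
    intro N
    induction N with
    | zero => intro m; simp
    | succ N ih =>
      intro m
      have h1 := (han m t₀ (hSV h₀)).analyticOrderAt_deriv_add_one
      simp only [hz m, sub_zero] at h1
      have h2 : deriv (h m) =ᶠ[nhds t₀] (fun _ => α) * h (m + 1) + (fun _ => β) * h (m - 1) := by
        filter_upwards [ht₀] with s hs
        exact (hd m s hs).deriv
      rw [← h1, analyticOrderAt_congr h2]
      push_cast
      gcongr
      refine le_trans (le_min ?_ ?_) le_analyticOrderAt_add
      · rw [analyticOrderAt_mul analyticAt_const (han _ t₀ (hSV h₀))]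
        exact (ih _).trans le_add_self
      · rw [analyticOrderAt_mul analyticAt_const (han _ t₀ (hSV h₀))]
        exact (ih _).trans le_add_self
  have htop : analyticOrderAt (h m) t₀ = ⊤ := ENat.eq_top_iff_forall_ge.mpr fun N => hord N m
  have hev := analyticOrderAt_eq_top.mp htop
  exact ((han m).mono hSV).eqOn_of_preconnected_of_eventuallyEq (g := fun _ => 0)
    (fun _ _ => analyticAt_const) hS h₀ hev ht

/-- At t = 0 only the term n = 0 of Graf's series survives, which gives the initial condition. -/
theorem extend_waveJ_zero (n : ℤ) : extend waveJ n 0 0 = if n = 0 then 1 else 0 := by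
  have hphi : phi 0 0 = 1 := by
    rw [phi, (phiCoeff_expBounded 0).powSum_eq_add]
    simp [phiCoeff]
  rw [extend]
  by_cases h : n = 0
  · simp [h, waveJ, hphi]
  · have : n.natAbs ≠ 0 := by omega
    simp [waveJ, this, h]

/-- **Graf's addition theorem** for the Hankel functions, in terms of cylinder waves. -/
theorem hasSum_graf_wave {x y : ℂ} (hxy : ‖y‖ < ‖x‖) (m : ℤ) :
    HasSum (fun n : ℤ => extend waveH (m + n) x (conj x) * extend waveJ n (conj y) y)
      (extend waveH m (x - y) (conj (x - y))) := by
  obtain ⟨r, hyr, hrx⟩ := exists_between hxy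
  have hr : 0 < r := (norm_nonneg y).trans_lt hyr
  have key : ∀ m, ∃ u : ℤ → ℝ, Summable u ∧ ∀ (n : ℤ) (z w : ℂ), ‖z‖ ≤ r → ‖w‖ ≤ r →
      ‖extend waveH (m + n) x (conj x) * extend waveJ n z w‖ ≤ u n :=
    exists_summable_bound hr hrx
  have hsum : ∀ (m : ℤ) (z w : ℂ), ‖z‖ ≤ r → ‖w‖ ≤ r →
      Summable fun n : ℤ => extend waveH (m + n) x (conj x) * extend waveJ n z w :=
    fun m z w hz hw => by
      obtain ⟨u, hu, h⟩ := key m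
      exact Summable.of_norm_bounded hu fun n => h n z w hz hw
  -- The second argument is conj x - t conj y rather than the conjugate of x - ty: this is
  -- holomorphic in t, and the two agree for real t.
  set f : ℤ → ℂ → ℂ := fun m t => extend waveH m (x - t * y) (conj x - t * conj y) with hf
  set g : ℤ → ℂ → ℂ := fun m t =>
    ∑' n : ℤ, extend waveH (m + n) x (conj x) * extend waveJ n (t * conj y) (t * y) with hg
  set V₁ : Set ℂ := {t | ‖t * y‖ < r} with hV₁
  have hV₁o : IsOpen V₁ := isOpen_lt (by fun_prop) continuous_const
  set V₂ : Set ℂ := {t | (x - t * y) * (conj x - t * conj y) ∈ Complex.slitPlane} with hV₂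
  have hV₂o : IsOpen V₂ := Complex.isOpen_slitPlane.preimage
    (f := fun t : ℂ => (x - t * y) * (conj x - t * conj y)) (by fun_prop)
  have hconj : ∀ t : ℂ, ‖t * conj y‖ = ‖t * y‖ := fun t => by simp
  have hlin : ∀ a t : ℂ, HasDerivAt (fun t : ℂ => t * a) a t := fun a t => by
    simpa using (hasDerivAt_id t).mul_const a
  have hfd : ∀ m, ∀ t ∈ V₂,
      HasDerivAt (f m) (-y * f (m - 1) t - -conj y * f (m + 1) t) t := fun m t ht =>
    isLadder_waveH.hasDerivAt_extend m (z := fun t => x - t * y)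
      (w := fun t => conj x - t * conj y) ht ((hlin y t).const_sub x)
      ((hlin (conj y) t).const_sub (conj x))
  have hgd : ∀ m, ∀ t ∈ V₁,
      HasDerivAt (g m) (conj y * g (m + 1) t - y * g (m - 1) t) t := fun m t ht => by
    obtain ⟨u, hu, hub⟩ := key m
    have hterm : ∀ (n : ℤ) (t : ℂ), HasDerivAt
        (fun t => extend waveH (m + n) x (conj x) * extend waveJ n (t * conj y) (t * y))
        (extend waveH (m + n) x (conj x) * (conj y * extend waveJ (n - 1) (t * conj y) (t * y)
          - y * extend waveJ (n + 1) (t * conj y) (t * y))) t := fun n t =>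
      (isLadder_waveJ.hasDerivAt_extend n (z := fun t => t * conj y) (w := fun t => t * y) trivial
        (hlin _ t) (hlin _ t)).const_mul _
    have hdiff : ∀ n : ℤ, DifferentiableOn ℂ
        (fun t => extend waveH (m + n) x (conj x) * extend waveJ n (t * conj y) (t * y)) V₁ :=
      fun n t _ => (hterm n t).differentiableAt.differentiableWithinAt
    have hbound : ∀ (n : ℤ) (t : ℂ), t ∈ V₁ →
        ‖extend waveH (m + n) x (conj x) * extend waveJ n (t * conj y) (t * y)‖ ≤ u n :=
      fun n t ht => hub n _ _ (by rw [hconj]; exact le_of_lt ht) (le_of_lt ht)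
    have h1 := Complex.hasSum_deriv_of_summable_norm hu hdiff hV₁o hbound ht
    have h2 := ((Complex.differentiableOn_tsum_of_summable_norm hu hdiff hV₁o hbound)
      |>.differentiableAt (hV₁o.mem_nhds ht)).hasDerivAt
    -- Reindexing by n ∓ 1 turns the shifts of the order of the Bessel waves into shifts of m.
    have h3 : HasSum (fun n : ℤ => extend waveH (m + n) x (conj x) *
        (conj y * extend waveJ (n - 1) (t * conj y) (t * y)
          - y * extend waveJ (n + 1) (t * conj y) (t * y)))
        (conj y * g (m + 1) t - y * g (m - 1) t) := by
      have hs : ∀ m : ℤ, HasSum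
          (fun n : ℤ => extend waveH (m + n) x (conj x) * extend waveJ n (t * conj y) (t * y))
          (g m t) := fun m =>
        (hsum m _ _ (by rw [hconj]; exact le_of_lt ht) (le_of_lt ht)).hasSum
      have ha := ((Equiv.addRight (-1 : ℤ)).hasSum_iff.mpr (hs (m + 1))).mul_left (conj y)
      have hb := ((Equiv.addRight (1 : ℤ)).hasSum_iff.mpr (hs (m - 1))).mul_left y
      refine (ha.sub hb).congr_fun fun n => ?_
      simp only [Function.comp, Equiv.coe_addRight]
      rw [show m + 1 + (n + -1) = m + n by ring, show m - 1 + (n + 1) = m + n by ring,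
        ← sub_eq_add_neg]
      ring
    have h4 : (fun n : ℤ => deriv (fun t => extend waveH (m + n) x (conj x) *
        extend waveJ n (t * conj y) (t * y)) t) = _ := funext fun n => (hterm n t).deriv
    rw [h4] at h1
    rw [← h1.unique h3]
    exact h2
  -- For real s the product of the two arguments is |x - sy|², positive because |sy| < |x|, hence
  -- off the cut.
  have hsub : (fun s : ℝ => (s : ℂ)) '' Set.Icc 0 1 ⊆ V₁ ∩ V₂ := by
    rintro _ ⟨s, ⟨hs0, hs1⟩, rfl⟩
    have hle : ‖(s : ℂ) * y‖ ≤ ‖y‖ := by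
      rw [norm_mul, Complex.norm_real, Real.norm_of_nonneg hs0]
      exact mul_le_of_le_one_left (norm_nonneg _) hs1
    refine ⟨hle.trans_lt hyr, ?_⟩
    have hne : x - s * y ≠ 0 := fun h => by
      rw [sub_eq_zero] at h
      rw [← h] at hle
      linarith
    have : (x - s * y) * (conj x - s * conj y) = (Complex.normSq (x - s * y) : ℂ) := by
      rw [← Complex.mul_conj]
      simp
    rw [hV₂, Set.mem_ofPred_eq, this]
    exact Complex.ofReal_mem_slitPlane.mpr (Complex.normSq_pos.mpr hne)
  have hpre : IsPreconnected ((fun s : ℝ => (s : ℂ)) '' Set.Icc 0 1) :=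
    isPreconnected_Icc.image _ Complex.continuous_ofReal.continuousOn
  have hzero := eq_zero_of_linear_system (hV₁o.inter hV₂o) hsub hpre
    (t₀ := 0) ⟨0, by simp, by simp⟩ (h := fun m t => f m t - g m t) (α := conj y) (β := -y)
    (fun m t ht => by
      refine HasDerivAt.congr_deriv ((hfd m t ht.2).sub (hgd m t ht.1)) ?_
      ring)
    (fun m => by
      simp only [hf, hg, zero_mul, sub_zero, extend_waveJ_zero]
      rw [tsum_eq_single 0 (fun n hn => by simp [hn])]
      simp) m (t := 1) ⟨1, by simp, by simp⟩
  have h1 := (hsum m (conj y) y (by simpa using hyr.le) hyr.le).hasSum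
  have h2 : ∑' n : ℤ, extend waveH (m + n) x (conj x) * extend waveJ n (conj y) y
      = extend waveH m (x - y) (conj (x - y)) := by
    have := (sub_eq_zero.mp hzero).symm
    simpa [hf, hg] using this
  rwa [h2] at h1

/-! ## Return to the cylinder functions -/

/-- The unit vector in the direction of `x`. -/
def dir (x : ℂ) : ℂ := Complex.exp (Complex.I * (Complex.arg x : ℂ))

theorem dir_ne_zero (x : ℂ) : dir x ≠ 0 := Complex.exp_ne_zero _

theorem phase_eq (n : ℤ) (x : ℂ) : phase n x = dir x ^ n := by
  rw [phase, dir, ← Complex.exp_int_mul]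
  congr 1
  ring

theorem norm_mul_dir (x : ℂ) : (‖x‖ : ℂ) * dir x = x := by
  rw [dir, mul_comm Complex.I]
  exact Complex.norm_mul_exp_arg_mul_I x

theorem norm_mul_dir_inv (x : ℂ) : (‖x‖ : ℂ) * (dir x)⁻¹ = conj x := by
  conv_rhs => rw [← norm_mul_dir x]
  rw [map_mul, Complex.conj_ofReal, dir, ← Complex.exp_neg, ← Complex.exp_conj]
  simp

theorem half_norm_mul_dir (x : ℂ) : (‖x‖ / 2 * dir x : ℂ) = x / 2 := by
  rw [div_mul_eq_mul_div, norm_mul_dir]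

theorem half_norm_mul_dir_inv (x : ℂ) : (‖x‖ / 2 * (dir x)⁻¹ : ℂ) = conj (x / 2) := by
  rw [div_mul_eq_mul_div, norm_mul_dir_inv, map_div₀, map_ofNat]

theorem besselJNat_eq (n : ℕ) (r : ℝ) :
    (besselJNat n r : ℂ) = ((r : ℂ) / 2) ^ n * phi n ((r / 2 : ℂ) * (r / 2)) := by
  rw [besselJNat, phi, powSum, ← tsum_mul_left, Complex.ofReal_tsum]
  refine tsum_congr fun k => ?_
  rw [phiCoeff]
  push_cast
  rw [pow_add, pow_mul]
  ring

theorem tsum_psi_eq (n : ℕ) (r : ℝ) :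
    ((∑' k : ℕ, (digammaSucc k + digammaSucc (n + k)) *
        ((-1) ^ k / ((k ! : ℝ) * ((n + k)! : ℝ))) * (r / 2) ^ (2 * k + n) : ℝ) : ℂ)
      = ((r : ℂ) / 2) ^ n * psi n ((r / 2 : ℂ) * (r / 2)) := by
  rw [psi, powSum, ← tsum_mul_left, Complex.ofReal_tsum]
  refine tsum_congr fun k => ?_
  rw [psiCoeff, phiCoeff]
  push_cast
  rw [pow_add, pow_mul]
  ring

theorem sum_sing_eq (n : ℕ) {r : ℝ} (hr : 0 < r) :
    ((∑ k ∈ Finset.range n,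
        ((n - k - 1)! : ℝ) / (k ! : ℝ) * (r / 2) ^ (2 * (k : ℤ) - (n : ℤ)) : ℝ) : ℂ)
      = (((r : ℂ) / 2) ^ n)⁻¹ * sing n ((r / 2 : ℂ) * (r / 2)) := by
  have hr' : (r / 2 : ℂ) ≠ 0 := by
    have : (r : ℂ) ≠ 0 := by exact_mod_cast hr.ne'
    simpa using this
  rw [sing, Finset.mul_sum, Complex.ofReal_sum]
  refine Finset.sum_congr rfl fun k _ => ?_
  push_cast
  rw [zpow_sub₀ hr', zpow_natCast, zpow_mul, zpow_ofNat, zpow_natCast, pow_two]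
  field_simp

/-- Used with e = `dir x` and with its inverse; the inverse exchanges z and w, as negative orders
require. -/
theorem besselJNat_mul_pow (n : ℕ) (r : ℝ) {e : ℂ} (he : e ≠ 0) :
    (besselJNat n r : ℂ) * e ^ n = waveJ n (r / 2 * e) (r / 2 * e⁻¹) := by
  rw [besselJNat_eq, waveJ, show (r / 2 * e : ℂ) * (r / 2 * e⁻¹) = r / 2 * (r / 2) by field_simp,
    mul_pow]
  ring

theorem besselYNat_mul_pow (n : ℕ) {r : ℝ} (hr : 0 < r) {e : ℂ} (he : e ≠ 0) :
    (besselYNat n r : ℂ) * e ^ n = 1 / Real.pi * waveY n (r / 2 * e) (r / 2 * e⁻¹) := by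
  have hlog : Complex.log ((r / 2 : ℂ) * (r / 2)) = 2 * (Real.log (r / 2) : ℂ) := by
    rw [show ((r / 2 : ℂ) * (r / 2)) = (((r / 2) ^ 2 : ℝ) : ℂ) by push_cast; ring,
      ← Complex.ofReal_log (by positivity), Real.log_pow]
    push_cast
    ring
  have h : (r / 2 * e : ℂ) * (r / 2 * e⁻¹) = r / 2 * (r / 2) := by field_simp
  rw [waveY, ← besselJNat_mul_pow n r he, h, hlog, mul_pow, mul_pow, mul_inv, inv_pow, inv_inv,
    besselYNat, Complex.ofReal_sub, Complex.ofReal_sub, Complex.ofReal_mul, Complex.ofReal_mul,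
    Complex.ofReal_mul, Complex.ofReal_mul, tsum_psi_eq, sum_sing_eq n hr]
  push_cast
  ring

theorem orderSign_mul_pow {G : ℕ → ℂ} {F : ℕ → ℂ → ℂ → ℂ} {z w e : ℂ}
    (h1 : ∀ n : ℕ, G n * e ^ n = F n z w) (h2 : ∀ n : ℕ, G n * e⁻¹ ^ n = F n w z) (n : ℤ) :
    (orderSign n : ℂ) * G n.natAbs * e ^ n = extend F n z w := by
  rw [orderSign, extend]
  split_ifs with h
  · rw [← h2]
    have he : e ^ n = e⁻¹ ^ n.natAbs := by
      rw [inv_pow, ← zpow_natCast, ← zpow_neg]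
      congr 1
      omega
    rw [he]
    push_cast
    ring
  · rw [← h1]
    have he : e ^ n = e ^ n.natAbs := by
      rw [← zpow_natCast]
      congr 1
      omega
    rw [he]
    push_cast
    ring

theorem besselJ_mul_phase_neg (n : ℤ) (y : ℂ) :
    (besselJ n ‖y‖ : ℂ) * phase (-n) y = extend waveJ n (conj (y / 2)) (y / 2) := by
  rw [phase_eq, besselJ, Complex.ofReal_mul, zpow_neg, ← inv_zpow,
    ← half_norm_mul_dir_inv y, ← half_norm_mul_dir y]
  refine orderSign_mul_pow (G := fun n => (besselJNat n ‖y‖ : ℂ)) (fun n => ?_) (fun n => ?_) n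
  · have := besselJNat_mul_pow n ‖y‖ (inv_ne_zero (dir_ne_zero y))
    rwa [inv_inv] at this
  · rw [inv_inv]
    exact besselJNat_mul_pow n _ (dir_ne_zero y)

theorem hankel_mul_phase (n : ℤ) {x : ℂ} (hx : x ≠ 0) :
    hankel n ‖x‖ * phase n x = extend waveH n (x / 2) (conj (x / 2)) := by
  have hr : 0 < ‖x‖ := norm_pos_iff.mpr hx
  have key : ∀ (n : ℕ) (e : ℂ), e ≠ 0 →
      ((besselJNat n ‖x‖ : ℂ) + Complex.I * (besselYNat n ‖x‖ : ℂ)) * e ^ n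
        = waveH n (‖x‖ / 2 * e) (‖x‖ / 2 * e⁻¹) := fun n e he => by
    rw [waveH, ← besselJNat_mul_pow n _ he]
    linear_combination Complex.I * besselYNat_mul_pow n hr he
  rw [phase_eq, hankel, besselJ, besselY, Complex.ofReal_mul, Complex.ofReal_mul,
    ← half_norm_mul_dir_inv, ← half_norm_mul_dir,
    ← orderSign_mul_pow (G := fun n => (besselJNat n ‖x‖ : ℂ) + Complex.I * besselYNat n ‖x‖)
      (fun n => key n _ (dir_ne_zero x)) (fun n => ?_) n]
  · ring
  · have := key n _ (inv_ne_zero (dir_ne_zero x))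
    rwa [inv_inv] at this

/-- The outgoing cylinder wave `H_n(|x|) e^{inθ_x}`. -/
def outgoing (n : ℤ) (x : ℂ) : ℂ := hankel n ‖x‖ * phase n x

/-- **Graf's addition theorem** for the Hankel functions. -/
theorem hasSum_RHTerm {x y : ℂ} (hxy : ‖y‖ < ‖x‖) (m : ℤ) :
    HasSum (RHTerm m x y) (outgoing m (x - y)) := by
  have hx : x ≠ 0 := norm_pos_iff.mp ((norm_nonneg y).trans_lt hxy)
  have hne : x - y ≠ 0 := fun h => by
    rw [sub_eq_zero] at h
    exact hxy.ne (by rw [h])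
  have h := hasSum_graf_wave (x := x / 2) (y := y / 2) (by simpa using by linarith) m
  rw [← sub_div, ← hankel_mul_phase m hne] at h
  refine h.congr_fun fun n => ?_
  rw [RHTerm, mul_assoc, besselJ_mul_phase_neg, hankel_mul_phase _ hx]

/-! ## Geometry of the quadtree -/

namespace Configuration

variable {ι : Type*} (S : Configuration ι)

theorem cellSide_pos (L : ℕ) : 0 < S.cellSide L := div_pos S.side_pos (by positivity)

theorem cellSide_eq_pow_mul {L L' : ℕ} (h : L ≤ L') :
    S.cellSide L = 2 ^ (L' - L) * S.cellSide L' := by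
  obtain ⟨d, rfl⟩ := Nat.exists_eq_add_of_le h
  rw [Nat.add_sub_cancel_left, cellSide, cellSide, pow_add]
  field_simp

theorem center_re (C : Cell) :
    (S.center C).re = S.corner.re + (C.ix + 1 / 2) * S.cellSide C.level := by
  simp [center]

theorem center_im (C : Cell) :
    (S.center C).im = S.corner.im + (C.iy + 1 / 2) * S.cellSide C.level := by
  simp [center]

theorem adjacent_of_overlap {C D : Cell}
    (h1 : C.ix * S.cellSide C.level ≤ (D.ix + 1) * S.cellSide D.level)
    (h2 : D.ix * S.cellSide D.level ≤ (C.ix + 1) * S.cellSide C.level)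
    (h3 : C.iy * S.cellSide C.level ≤ (D.iy + 1) * S.cellSide D.level)
    (h4 : D.iy * S.cellSide D.level ≤ (C.iy + 1) * S.cellSide C.level) : S.Adjacent C D := by
  have hc := S.cellSide_pos C.level
  have hd := S.cellSide_pos D.level
  -- The common point takes the larger of the two lower ends in each coordinate.
  refine ⟨⟨S.corner.re + max (C.ix * S.cellSide C.level) (D.ix * S.cellSide D.level),
    S.corner.im + max (C.iy * S.cellSide C.level) (D.iy * S.cellSide D.level)⟩, ?_, ?_⟩ <;>
  · simp only [closedSquare, Set.mem_ofPred_eq, add_sub_cancel_left, Set.mem_Icc, le_max_iff,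
      max_le_iff, le_refl, true_or, or_true, true_and]
    refine ⟨⟨?_, ?_⟩, ?_, ?_⟩ <;> nlinarith

theorem mem_closedSquare_of_mem_points [Fintype ι] {C : Cell} {j : ι} (hj : j ∈ S.points C) :
    S.y j ∈ S.closedSquare C := by
  have key : ∀ {L i : ℕ} {t : ℝ}, S.InStrip L i t →
      t ∈ Set.Icc (i * S.cellSide L) ((i + 1) * S.cellSide L) := fun h =>
    ⟨h.1, h.2.elim le_of_lt fun h => h.2.le⟩
  simp only [points, Finset.mem_filter, Finset.mem_univ, true_and] at hj
  exact ⟨key hj.1, key hj.2⟩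

theorem mem_closedSquare_iff {C : Cell} {z : ℂ} : z ∈ S.closedSquare C ↔
    |(z - S.center C).re| ≤ S.cellSide C.level / 2 ∧
      |(z - S.center C).im| ≤ S.cellSide C.level / 2 := by
  simp only [closedSquare, Set.mem_ofPred_eq, Set.mem_Icc, Complex.sub_re, Complex.sub_im,
    center_re, center_im, abs_le]
  constructor
  · rintro ⟨⟨h1, h2⟩, h3, h4⟩
    refine ⟨⟨?_, ?_⟩, ?_, ?_⟩ <;> linarith
  · rintro ⟨⟨h1, h2⟩, h3, h4⟩
    refine ⟨⟨?_, ?_⟩, ?_, ?_⟩ <;> linarith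

/-- Disjoint dyadic intervals have a gap of at least the length of the shorter one. -/
theorem center_dist_of_disjoint {a b e : ℕ} {s : ℝ} (hs : 0 < s)
    (h : ¬ (a * (2 ^ e * s) ≤ (b + 1) * s ∧ b * s ≤ (a + 1) * (2 ^ e * s))) :
    (2 ^ e + 3) / 2 * s ≤ |(b + 1 / 2) * s - (a + 1 / 2) * (2 ^ e * s)| := by
  -- The bound is the sum of the half lengths, (2 ^ e + 1) / 2 * s, plus a gap s; the endpoints are
  -- integer multiples of s, so disjointness forces that gap.
  rw [not_and_or, not_le, not_le, ← mul_assoc, ← mul_assoc, mul_lt_mul_iff_left₀ hs,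
    mul_lt_mul_iff_left₀ hs] at h
  rcases h with h | h
  · have h' : b + 1 + 1 ≤ a * 2 ^ e := by
      have : b + 1 < a * 2 ^ e := by exact_mod_cast h
      omega
    have h' : (b : ℝ) + 1 + 1 ≤ a * 2 ^ e := by exact_mod_cast h'
    rw [le_abs]
    right
    nlinarith
  · have h' : (a + 1) * 2 ^ e + 1 ≤ b := by
      have : (a + 1) * 2 ^ e < b := by exact_mod_cast h
      omega
    have h' : ((a : ℝ) + 1) * 2 ^ e + 1 ≤ b := by exact_mod_cast h'
    rw [le_abs]
    left
    nlinarith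

/-- A point of `C` is closer to the centroid of `C` than a cell that is separated from `C` and at
most four times smaller. -/
theorem norm_sub_center_lt {C D : Cell} (hCD : C.level ≤ D.level) (hDC : D.level ≤ C.level + 2)
    (hadj : ¬ S.Adjacent C D) {z : ℂ} (hz : z ∈ S.closedSquare C) :
    ‖z - S.center C‖ < ‖S.center D - S.center C‖ := by
  set s := S.cellSide D.level with hs_def
  have hs : 0 < s := S.cellSide_pos _
  obtain ⟨e, he, hC⟩ : ∃ e : ℕ, e ≤ 2 ∧ S.cellSide C.level = 2 ^ e * s :=
    ⟨_, by omega, S.cellSide_eq_pow_mul hCD⟩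
  have hfar : (2 ^ e + 3) / 2 * s ≤ ‖S.center D - S.center C‖ := by
    by_contra! hlt
    refine hadj ?_
    have hx : |(D.ix + 1 / 2) * s - (C.ix + 1 / 2) * (2 ^ e * s)| < (2 ^ e + 3) / 2 * s := by
      refine lt_of_le_of_lt ?_ hlt
      refine le_trans (le_of_eq ?_) (Complex.abs_re_le_norm _)
      rw [Complex.sub_re, center_re, center_re, hC, add_sub_add_left_eq_sub]
    have hy : |(D.iy + 1 / 2) * s - (C.iy + 1 / 2) * (2 ^ e * s)| < (2 ^ e + 3) / 2 * s := by
      refine lt_of_le_of_lt ?_ hlt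
      refine le_trans (le_of_eq ?_) (Complex.abs_im_le_norm _)
      rw [Complex.sub_im, center_im, center_im, hC, add_sub_add_left_eq_sub]
    have hx' := not_not.mp (mt (center_dist_of_disjoint hs) hx.not_ge)
    have hy' := not_not.mp (mt (center_dist_of_disjoint hs) hy.not_ge)
    refine S.adjacent_of_overlap ?_ ?_ ?_ ?_ <;> rw [hC]
    exacts [hx'.1, hx'.2, hy'.1, hy'.2]
  refine lt_of_lt_of_le ?_ hfar
  obtain ⟨h1, h2⟩ := S.mem_closedSquare_iff.mp hz
  rw [hC] at h1 h2
  refine lt_of_pow_lt_pow_left₀ 2 (by positivity) ?_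
  rw [Complex.sq_norm, Complex.normSq_apply, ← pow_two, ← pow_two]
  have h1' := sq_le_sq' (by linarith [(abs_le.mp h1).1]) (abs_le.mp h1).2
  have h2' := sq_le_sq' (by linarith [(abs_le.mp h2).1]) (abs_le.mp h2).2
  have hs2 : 0 < s ^ 2 := by positivity
  -- The half diagonal 2 ^ e * s / √2 is compared with (2 ^ e + 3) / 2 * s. The inequality holds for
  -- e ≤ 2 and fails for e = 3.
  interval_cases e <;> norm_num at * <;> nlinarith

theorem level_parent (D : Cell) : D.parent.level = D.level - 1 := rfl

theorem cellSide_parent {D : Cell} (hD : 1 ≤ D.level) :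
    S.cellSide D.parent.level = 2 * S.cellSide D.level := by
  rw [level_parent, S.cellSide_eq_pow_mul (Nat.sub_le D.level 1),
    show D.level - (D.level - 1) = 1 by omega, pow_one]

theorem abs_center_sub_center_parent_re {D : Cell} (hD : 1 ≤ D.level) :
    |(S.center D - S.center D.parent).re| = S.cellSide D.level / 2 := by
  have hs := S.cellSide_pos D.level
  rw [Complex.sub_re, center_re, center_re, S.cellSide_parent hD, add_sub_add_left_eq_sub]
  have h : D.ix = 2 * D.parent.ix ∨ D.ix = 2 * D.parent.ix + 1 := by
    simp only [Cell.parent]; omega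
  rcases h with h | h <;> rw [h]
  · rw [abs_of_nonpos] <;> push_cast <;> linarith
  · rw [abs_of_nonneg] <;> push_cast <;> linarith

theorem abs_center_sub_center_parent_im {D : Cell} (hD : 1 ≤ D.level) :
    |(S.center D - S.center D.parent).im| = S.cellSide D.level / 2 := by
  have hs := S.cellSide_pos D.level
  rw [Complex.sub_im, center_im, center_im, S.cellSide_parent hD, add_sub_add_left_eq_sub]
  have h : D.iy = 2 * D.parent.iy ∨ D.iy = 2 * D.parent.iy + 1 := by
    simp only [Cell.parent]; omega
  rcases h with h | h <;> rw [h]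
  · rw [abs_of_nonpos] <;> push_cast <;> linarith
  · rw [abs_of_nonneg] <;> push_cast <;> linarith

theorem closedSquare_subset_parent {D : Cell} (hD : 1 ≤ D.level) :
    S.closedSquare D ⊆ S.closedSquare D.parent := by
  intro z hz
  rw [mem_closedSquare_iff] at hz ⊢
  have hx := S.abs_center_sub_center_parent_re hD
  have hy := S.abs_center_sub_center_parent_im hD
  rw [S.cellSide_parent hD, ← sub_add_sub_cancel z (S.center D), Complex.add_re, Complex.add_im]
  exact ⟨(abs_add_le _ _).trans (by linarith [hz.1]), (abs_add_le _ _).trans (by linarith [hz.2])⟩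

theorem ancestor_self (D : Cell) : D.ancestor D.level = D := by
  simp [Cell.ancestor]

theorem ancestor_parent {D : Cell} {L : ℕ} (hL : L < D.level) :
    D.ancestor L = D.parent.ancestor L := by
  rw [Cell.ancestor, Cell.ancestor, level_parent,
    show D.level - L = (D.level - 1 - L) + 1 by omega, Function.iterate_succ_apply]

theorem closedSquare_subset_ancestor {D : Cell} {L : ℕ} (hL : L ≤ D.level) :
    S.closedSquare D ⊆ S.closedSquare (D.ancestor L) := by
  induction h : D.level - L generalizing D with
  | zero => rw [show L = D.level by omega, ancestor_self]
  | succ n ih =>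
    rw [ancestor_parent (by omega)]
    have hl := level_parent D
    exact (S.closedSquare_subset_parent (by omega)).trans (ih (by omega) (by omega))

theorem center_ne_center_parent {D : Cell} (hD : 1 ≤ D.level) :
    S.center D - S.center D.parent ≠ 0 := fun h => by
  have h1 := S.abs_center_sub_center_parent_re hD
  have := S.cellSide_pos D.level
  rw [h] at h1
  simp at h1
  linarith

/-- With s the side of D, the two centres are s / √2 apart, while a point outside the parent's
square is farther than s, half the parent's side, from its centre. -/
theorem norm_center_sub_center_parent_lt {D : Cell} (hD : 1 ≤ D.level) {z : ℂ}
    (hz : z ∉ S.closedSquare D.parent) :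
    ‖S.center D - S.center D.parent‖ < ‖z - S.center D.parent‖ := by
  have hs := S.cellSide_pos D.level
  have hfar : S.cellSide D.level < ‖z - S.center D.parent‖ := by
    by_contra! h
    refine hz (S.mem_closedSquare_iff.mpr ?_)
    rw [S.cellSide_parent hD]
    exact ⟨(Complex.abs_re_le_norm _).trans (by linarith),
      (Complex.abs_im_le_norm _).trans (by linarith)⟩
  refine lt_trans ?_ hfar
  refine lt_of_pow_lt_pow_left₀ 2 hs.le ?_
  rw [Complex.sq_norm, Complex.normSq_apply, ← pow_two, ← pow_two, ← sq_abs,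
    ← sq_abs (S.center D - S.center D.parent).im, S.abs_center_sub_center_parent_re hD,
    S.abs_center_sub_center_parent_im hD]
  nlinarith

/-- The square of C misses that of the ancestor, which contains the square of `D.parent` because L <
`D.level`. -/
theorem norm_center_sub_center_parent_lt_of_wellSeparated [Fintype ι] {D C : Cell} {L : ℕ}
    (hL : L < D.level) (hC : C ∈ S.wellSeparated (D.ancestor L)) {j : ι} (hj : j ∈ S.points C) :
    ‖S.center D - S.center D.parent‖ < ‖S.y j - S.center D.parent‖ := by
  refine S.norm_center_sub_center_parent_lt (by omega) fun hmem => ?_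
  simp only [wellSeparated, Finset.mem_filter] at hC
  refine hC.2.2.1 ⟨S.y j, S.mem_closedSquare_of_mem_points hj, ?_⟩
  rw [ancestor_parent hL]
  exact S.closedSquare_subset_ancestor (by rw [level_parent]; omega) hmem

theorem norm_sub_center_lt_of_wellSeparated [Fintype ι] {D C : Cell}
    (hC : C ∈ S.wellSeparated D) (hlevel : D.level ≤ C.level + 2) {j : ι} (hj : j ∈ S.points C) :
    ‖S.y j - S.center C‖ < ‖S.center D - S.center C‖ := by
  simp only [wellSeparated, Finset.mem_filter] at hC
  refine S.norm_sub_center_lt ?_ hlevel hC.2.2.1 (S.mem_closedSquare_of_mem_points hj)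
  rcases hC.2.2.2 with h | h <;> omega

end Configuration

/-! ### Parents and children in the tree -/

theorem Cell.parent_child (P : Cell) (a : Fin 2 × Fin 2) : (P.child a).parent = P := by
  ext <;> simp only [Cell.child, Cell.parent] <;> omega

theorem Quadtree.child_mem_cells (T : Quadtree) {P : Cell} (hP : P ∈ T.divided)
    (a : Fin 2 × Fin 2) : P.child a ∈ T.cells := by
  simp only [Quadtree.cells, Finset.mem_insert, Finset.mem_biUnion, Finset.mem_image]
  exact Or.inr ⟨P, hP, a, Finset.mem_univ _, rfl⟩

theorem Quadtree.parent_mem_cells (T : Quadtree) {D : Cell} (hD : D ∈ T.cells)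
    (hl : 1 ≤ D.level) : D.parent ∈ T.cells := by
  simp only [Quadtree.cells, Finset.mem_insert, Finset.mem_biUnion, Finset.mem_image] at hD
  rcases hD with rfl | ⟨P, hP, a, -, rfl⟩
  · simp [Cell.root] at hl
  · rw [Cell.parent_child]
    rcases T.reachable P hP with rfl | ⟨Q, hQ, b, rfl⟩
    · simp [Quadtree.cells]
    · exact T.child_mem_cells hQ b

/-! ## The addition theorem in the form of the remainders -/

theorem orderSign_neg_mul (n : ℤ) : (orderSign (-n) : ℂ) * (-1) ^ n = orderSign n := by
  obtain ⟨N, rfl | rfl⟩ := n.eq_nat_or_neg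
  · rcases N with _ | N
    · simp [orderSign]
    · rw [orderSign, orderSign, if_pos (by omega), if_neg (by omega), zpow_natCast, Int.natAbs_neg,
        Int.natAbs_natCast]
      push_cast
      rw [← mul_pow]
      simp
  · rcases N with _ | N
    · simp [orderSign]
    · rw [orderSign, orderSign, if_neg (by omega), if_pos (by omega), zpow_neg, zpow_natCast,
        Int.natAbs_neg, Int.natAbs_natCast, ← inv_pow]
      norm_num

theorem hankel_neg_mul (n : ℤ) (r : ℝ) : hankel (-n) r * (-1) ^ n = hankel n r := by
  simp only [hankel, besselJ, besselY, Int.natAbs_neg]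
  push_cast
  rw [← orderSign_neg_mul n]
  ring

theorem besselJ_neg_mul (n : ℤ) (r : ℝ) : (besselJ (-n) r : ℂ) * (-1) ^ n = besselJ n r := by
  simp only [besselJ, Int.natAbs_neg]
  push_cast
  rw [← orderSign_neg_mul n]
  ring

theorem dir_neg {x : ℂ} (hx : x ≠ 0) : dir (-x) = -dir x := by
  have h1 := norm_mul_dir (-x)
  have h2 := norm_mul_dir x
  have h3 : (‖x‖ : ℂ) ≠ 0 := by exact_mod_cast (norm_pos_iff.mpr hx).ne'
  rw [norm_neg] at h1
  refine mul_left_cancel₀ h3 ?_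
  rw [h1, mul_neg, h2]

theorem phase_neg_arg (n : ℤ) {x : ℂ} (hx : x ≠ 0) : phase n (-x) = (-1) ^ n * phase n x := by
  rw [phase_eq, phase_eq, dir_neg hx, neg_eq_neg_one_mul, mul_zpow]

theorem neg_one_zpow_neg (n : ℤ) : (-1 : ℂ) ^ (-n) = (-1) ^ n := by
  rw [zpow_neg, ← inv_zpow]
  norm_num

theorem outgoing_neg (n : ℤ) {x : ℂ} (hx : x ≠ 0) :
    outgoing (-n) (-x) = hankel n ‖x‖ * phase (-n) x := by
  rw [outgoing, norm_neg, phase_neg_arg _ hx, neg_one_zpow_neg, ← mul_assoc, hankel_neg_mul]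

/-- Negating an order and reflecting a point both give a sign (-1)ⁿ, and these cancel. The barred
series is thus Graf's series at the reflected points, run backwards. Reflection shifts the polar
angle by π only away from 0. -/
theorem RHbarTerm_eq (m : ℤ) {x y : ℂ} (hx : x ≠ 0) (hy : y ≠ 0) (n : ℤ) :
    RHbarTerm m x y n = RHTerm (-m) (-x) (-y) (-n) := by
  have h := outgoing_neg (m + n) hx
  rw [outgoing] at h
  rw [RHbarTerm, RHTerm, ← neg_add, h, neg_neg, norm_neg, phase_neg_arg n hy, ← besselJ_neg_mul n]
  ring

theorem hasSum_RHbarTerm {x y : ℂ} (hxy : ‖y‖ < ‖x‖) (hy : y ≠ 0) (m : ℤ) :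
    HasSum (RHbarTerm m x y) (outgoing (-m) (y - x)) := by
  have hx : x ≠ 0 := norm_pos_iff.mp ((norm_nonneg y).trans_lt hxy)
  have h := hasSum_RHTerm (x := -x) (y := -y) (by simpa using hxy) (-m)
  rw [← (Equiv.neg ℤ).hasSum_iff, show -x - -y = y - x by ring] at h
  exact h.congr_fun fun n => RHbarTerm_eq m hx hy n

/-- The tails of a series over the integers. -/
theorem tsum_tails_eq {f : ℤ → ℂ} (hf : Summable f) (p : ℕ) :
    (∑' r : ℕ, f ((p : ℤ) + 1 + (r : ℤ))) + ∑' r : ℕ, f (-(p : ℤ) - 1 - (r : ℤ))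
      = ∑' n, f n - ∑ n ∈ Finset.Icc (-(p : ℤ)) (p : ℤ), f n := by
  have h1 : Summable fun r : ℕ => f ((p : ℤ) + 1 + (r : ℤ)) :=
    hf.comp_injective (i := fun r : ℕ => (p : ℤ) + 1 + (r : ℤ)) fun a b h => by
      simp only at h; omega
  have h2 : Summable fun r : ℕ => f (-(p : ℤ) - 1 - (r : ℤ)) :=
    hf.comp_injective (i := fun r : ℕ => -(p : ℤ) - 1 - (r : ℤ)) fun a b h => by
      simp only at h; omega
  have hs := (Finset.Icc (-(p : ℤ)) (p : ℤ)).hasSum_compl_iff.mpr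
    (show HasSum f ((∑' n, f n - ∑ n ∈ Finset.Icc (-(p : ℤ)) (p : ℤ), f n)
      + ∑ n ∈ Finset.Icc (-(p : ℤ)) (p : ℤ), f n) by rw [sub_add_cancel]; exact hf.hasSum)
  let g : ℕ ⊕ ℕ → {n : ℤ // n ∉ Finset.Icc (-(p : ℤ)) (p : ℤ)} := Sum.elim
    (fun r => ⟨(p : ℤ) + 1 + r, by rw [Finset.mem_Icc]; omega⟩)
    (fun r => ⟨-(p : ℤ) - 1 - r, by rw [Finset.mem_Icc]; omega⟩)
  have hg : Function.Bijective g := by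
    constructor
    · rintro (a | a) (b | b) h <;> simp only [g, Sum.elim_inl, Sum.elim_inr, Subtype.mk.injEq] at h
      · congr 1; omega
      · omega
      · omega
      · congr 1; omega
    · rintro ⟨n, hn⟩
      rw [Finset.mem_Icc] at hn
      by_cases h : 0 ≤ n
      · exact ⟨Sum.inl (n - p - 1).toNat, Subtype.ext (by simp only [g, Sum.elim_inl]; omega)⟩
      · exact ⟨Sum.inr (-n - p - 1).toNat, Subtype.ext (by simp only [g, Sum.elim_inr]; omega)⟩
  let e := Equiv.ofBijective g hg
  have hsum := HasSum.sum (f := (fun n : {n : ℤ // n ∉ Finset.Icc (-(p : ℤ)) (p : ℤ)} => f n) ∘ e)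
    h1.hasSum h2.hasSum
  exact (e.hasSum_iff.mp hsum).unique hs

theorem RH_eq {x y : ℂ} (hxy : ‖y‖ < ‖x‖) (m : ℤ) (p : ℕ) :
    RH m p x y = outgoing m (x - y) - ∑ n ∈ Finset.Icc (-(p : ℤ)) (p : ℤ), RHTerm m x y n := by
  have h := hasSum_RHTerm hxy m
  rw [RH, tsum_tails_eq h.summable, h.tsum_eq]

/-- The substitution l = n + m makes the lopsided tails symmetric, |l| > p. -/
theorem RHbar_eq {x y : ℂ} (hxy : ‖y‖ < ‖x‖) (hy : y ≠ 0) (m : ℤ) (p : ℕ) :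
    RHbar m p x y = outgoing (-m) (y - x)
      - ∑ l ∈ Finset.Icc (-(p : ℤ)) (p : ℤ), RHbarTerm m x y (l - m) := by
  have h := (Equiv.subRight m).hasSum_iff.mpr (hasSum_RHbarTerm hxy hy m)
  have h2 := tsum_tails_eq h.summable p
  rw [h.tsum_eq] at h2
  simp only [Function.comp, Equiv.subRight_apply] at h2
  rw [← h2, RHbar]
  congr 2 <;> · ext r; congr 1; ring

/-! ## Local expansions -/

theorem phase_real_mul {k : ℝ} (hk : 0 < k) (n : ℤ) (x : ℂ) :
    phase n ((k : ℂ) * x) = phase n x := by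
  rw [phase, phase, Complex.arg_real_mul x hk]

theorem norm_real_mul {k : ℝ} (hk : 0 < k) (x : ℂ) : ‖(k : ℂ) * x‖ = k * ‖x‖ := by
  rw [norm_mul, Complex.norm_real, Real.norm_of_nonneg hk.le]

namespace Configuration

theorem L2L_ne_zero {ι : Type*} {S : Configuration ι} {k : ℝ} {D : Cell}
    (hk : 0 < k) (hD : 1 ≤ D.level) :
    (k : ℂ) * (S.center D - S.center D.parent) ≠ 0 :=
  mul_ne_zero (by exact_mod_cast hk.ne') (S.center_ne_center_parent hD)

variable {ι : Type*} [Fintype ι] (S : Configuration ι)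

/-- The local moment about `O_D` of the field points of `C`. -/
def cellField (k : ℝ) (D C : Cell) (m : ℤ) : ℂ :=
  ∑ j ∈ S.points C, outgoing (-m) ((k : ℂ) * (S.center D - S.y j)) * S.q j

theorem multipole_mul_kerM2L {k : ℝ} (hk : 0 < k) (D C : Cell) (m n : ℤ) :
    S.multipole k C n * S.kerM2L k D C m n = ∑ j ∈ S.points C,
      RHTerm (-m) ((k : ℂ) * (S.center D - S.center C)) ((k : ℂ) * (S.y j - S.center C)) n
        * S.q j := by
  rw [multipole, kerM2L, Finset.sum_mul]
  refine Finset.sum_congr rfl fun j _ => ?_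
  rw [RHTerm, phase_real_mul hk, phase_real_mul hk, norm_real_mul hk, norm_real_mul hk,
    show -m + n = n - m by ring]
  ring

/-! ### Multipole-to-local translation -/

section M2L

variable {S} {k : ℝ} {D C : Cell}

theorem norm_M2L_lt (hk : 0 < k) (hC : C ∈ S.wellSeparated D)
    (hl : D.level ≤ C.level + 2) {j : ι} (hj : j ∈ S.points C) :
    ‖(k : ℂ) * (S.y j - S.center C)‖ < ‖(k : ℂ) * (S.center D - S.center C)‖ := by
  rw [norm_real_mul hk, norm_real_mul hk]
  exact mul_lt_mul_of_pos_left (S.norm_sub_center_lt_of_wellSeparated hC hl hj) hk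

/-- Graf's theorem applies point by point, and the centre of C cancels from the difference of the
two arguments. -/
theorem hasSum_M2L (hk : 0 < k) (hC : C ∈ S.wellSeparated D) (hl : D.level ≤ C.level + 2)
    (m : ℤ) :
    HasSum (fun n : ℤ => S.multipole k C n * S.kerM2L k D C m n) (S.cellField k D C m) := by
  simp only [S.multipole_mul_kerM2L hk, cellField]
  refine hasSum_sum fun j hj => ?_
  have h := hasSum_RHTerm (norm_M2L_lt hk hC hl hj) (-m)
  rw [← mul_sub, sub_sub_sub_cancel_right] at h
  exact h.mul_right _

theorem sum_RH_eq (hk : 0 < k) (hC : C ∈ S.wellSeparated D) (hl : D.level ≤ C.level + 2)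
    (m : ℤ) (p : ℕ) :
    ∑ j ∈ S.points C, RH (-m) p ((k : ℂ) * (S.center D - S.center C))
        ((k : ℂ) * (S.y j - S.center C)) * S.q j
      = S.cellField k D C m - ∑ n ∈ Finset.Icc (-(p : ℤ)) (p : ℤ),
          S.multipole k C n * S.kerM2L k D C m n := by
  simp only [S.multipole_mul_kerM2L hk, cellField]
  rw [Finset.sum_comm, ← Finset.sum_sub_distrib]
  refine Finset.sum_congr rfl fun j hj => ?_
  rw [RH_eq (norm_M2L_lt hk hC hl hj), ← mul_sub, sub_sub_sub_cancel_right, sub_mul,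
    Finset.sum_mul]

end M2L

/-- The local moment about `O_D` of the field points in the well separated cells of the cells of
the levels `2, …, L` that contain `A`. -/
def farField (k : ℝ) (D A : Cell) (L : ℕ) (m : ℤ) : ℂ :=
  ∑ L₁ ∈ Finset.Icc 2 L, ∑ C ∈ S.wellSeparated (A.ancestor L₁), S.cellField k D C m

/-! ### Local-to-local translation -/

section L2L

variable {S} {k : ℝ} {D C : Cell}

theorem norm_L2L_lt (hk : 0 < k) {L : ℕ} (hL : L < D.level)
    (hC : C ∈ S.wellSeparated (D.ancestor L)) {j : ι} (hj : j ∈ S.points C) :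
    ‖(k : ℂ) * (S.center D - S.center D.parent)‖ < ‖(k : ℂ) * (S.y j - S.center D.parent)‖ := by
  rw [norm_real_mul hk, norm_real_mul hk]
  exact mul_lt_mul_of_pos_left (S.norm_center_sub_center_parent_lt_of_wellSeparated hL hC hj) hk

/-- `outgoing_neg` reverses the vector from the field point to the parent's centre, which produces
the barred series at index l - m. -/
theorem cellField_mul_kerL2L (hk : 0 < k) {L : ℕ} (hL : L < D.level)
    (hC : C ∈ S.wellSeparated (D.ancestor L)) (m l : ℤ) :
    S.cellField k D.parent C l * S.kerL2L k D m l = ∑ j ∈ S.points C,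
      RHbarTerm m ((k : ℂ) * (S.y j - S.center D.parent))
        ((k : ℂ) * (S.center D - S.center D.parent)) (l - m) * S.q j := by
  rw [cellField, kerL2L, Finset.sum_mul]
  refine Finset.sum_congr rfl fun j hj => ?_
  have hx : (k : ℂ) * (S.y j - S.center D.parent) ≠ 0 :=
    norm_pos_iff.mp ((norm_nonneg _).trans_lt (norm_L2L_lt hk hL hC hj))
  have h := outgoing_neg l hx
  rw [← mul_neg, neg_sub] at h
  rw [RHbarTerm, h, add_sub_cancel, phase_real_mul hk (l - m), ← norm_real_mul hk]
  ring

theorem hasSum_cellField_L2L (hk : 0 < k) {L : ℕ} (hL : L < D.level)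
    (hC : C ∈ S.wellSeparated (D.ancestor L)) (m : ℤ) :
    HasSum (fun l : ℤ => S.cellField k D.parent C l * S.kerL2L k D m l)
      (S.cellField k D C m) := by
  simp only [cellField_mul_kerL2L hk hL hC]
  refine hasSum_sum fun j hj => ?_
  have h := (Equiv.subRight m).hasSum_iff.mpr
    (hasSum_RHbarTerm (norm_L2L_lt hk hL hC hj) (L2L_ne_zero hk (by omega)) m)
  rw [← mul_sub, sub_sub_sub_cancel_right] at h
  exact h.mul_right _

theorem sum_RHbar_eq (hk : 0 < k) {L : ℕ} (hL : L < D.level)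
    (hC : C ∈ S.wellSeparated (D.ancestor L)) (m : ℤ) (p : ℕ) :
    ∑ j ∈ S.points C, RHbar m p ((k : ℂ) * (S.y j - S.center D.parent))
        ((k : ℂ) * (S.center D - S.center D.parent)) * S.q j
      = S.cellField k D C m - ∑ l ∈ Finset.Icc (-(p : ℤ)) (p : ℤ),
          S.cellField k D.parent C l * S.kerL2L k D m l := by
  simp only [cellField_mul_kerL2L hk hL hC]
  rw [Finset.sum_comm, cellField, ← Finset.sum_sub_distrib]
  refine Finset.sum_congr rfl fun j hj => ?_
  rw [RHbar_eq (norm_L2L_lt hk hL hC hj) (L2L_ne_zero hk (by omega)), ← mul_sub,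
    sub_sub_sub_cancel_right, sub_mul, Finset.sum_mul]

theorem hasSum_farField_L2L (hk : 0 < k) (hD : 3 ≤ D.level) (m : ℤ) :
    HasSum (fun l : ℤ => S.farField k D.parent D (D.level - 1) l * S.kerL2L k D m l)
      (S.farField k D D (D.level - 1) m) := by
  simp only [farField, Finset.sum_mul]
  refine hasSum_sum fun L₁ hL => hasSum_sum fun C hC => ?_
  rw [Finset.mem_Icc] at hL
  exact hasSum_cellField_L2L hk (by omega) hC m

theorem farField_parent (E : Cell) (hD : 3 ≤ D.level) (m : ℤ) :
    S.farField k E D (D.level - 1) m = S.farField k E D.parent D.parent.level m := by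
  rw [farField, farField, level_parent]
  refine Finset.sum_congr rfl fun L₁ hL => ?_
  rw [Finset.mem_Icc] at hL
  rw [ancestor_parent (by omega)]

theorem farField_self (hD : 2 ≤ D.level) (m : ℤ) :
    S.farField k D D D.level m = S.farField k D D (D.level - 1) m
      + ∑ C ∈ S.wellSeparated D, S.cellField k D C m := by
  obtain ⟨L, hL⟩ : ∃ L, D.level = L + 1 := ⟨D.level - 1, by omega⟩
  have h := ancestor_self D
  rw [hL] at h
  rw [farField, farField, hL, Nat.add_sub_cancel,
    ← Finset.insert_Icc_right_eq_Icc_add_one (by omega), Finset.sum_insert (by simp), h, add_comm]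

theorem exactLM_eq (hk : 0 < k)
    (hlevel : ∀ C ∈ S.wellSeparated D, D.level ≤ C.level + 2) (m : ℤ) :
    S.exactLM k D m = ∑ C ∈ S.wellSeparated D, S.cellField k D C m :=
  Finset.sum_congr rfl fun C hC => (hasSum_M2L hk hC (hlevel C hC) m).tsum_eq

/-- The exact local moments are those of all the field points in the cells met so far. -/
theorem exactLocal_eq (hk : 0 < k)
    (hlevel : ∀ D ∈ S.tree.cells, 2 ≤ D.level →
      ∀ C ∈ S.wellSeparated D, D.level ≤ C.level + 2)
    (hD : D ∈ S.tree.cells) (hD2 : 2 ≤ D.level) (m : ℤ) :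
    S.exactLocal k D m = S.farField k D D D.level m := by
  induction h : D.level generalizing D m with
  | zero => omega
  | succ L ih =>
    rw [← h, exactLocal, farField_self hD2, exactLM_eq hk (hlevel D hD hD2)]
    split_ifs with h3
    · have hl := level_parent D
      have hpar := S.tree.parent_mem_cells hD (by omega)
      have hsum := hasSum_farField_L2L (S := S) hk h3 m
      simp only [farField_parent (k := k) D.parent h3] at hsum
      rw [add_comm, ← hsum.tsum_eq]
      congr 1
      refine tsum_congr fun l => ?_
      rw [ih hpar (by omega) l (by omega), show D.parent.level = L by omega]
    -- At level 2 no ancestor contributes: the range of levels from 2 to 1 is empty.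
    · have : D.level - 1 = 1 := by omega
      rw [this, farField, Finset.Icc_eq_empty (by omega), Finset.sum_empty, zero_add]

end L2L

/-! ### Errors of the truncated translations -/

variable {S}

/-- The error of the multipole-to-local translations. -/
theorem exactLM_sub_approxLM {k : ℝ} (hk : 0 < k) {D : Cell}
    (hlevel : ∀ C ∈ S.wellSeparated D, D.level ≤ C.level + 2) (p : ℕ) (m : ℤ) :
    S.exactLM k D m - S.approxLM k p D m =
      ∑ C ∈ S.wellSeparated D,
        ((∑ n ∈ Finset.Icc (-(p : ℤ)) (p : ℤ),
            S.EM k p C n * hankel (n - m) (k * ‖S.center D - S.center C‖)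
              * phase (n - m) (S.center D - S.center C))
          + ∑ j ∈ S.points C,
              RH (-m) p ((k : ℂ) * (S.center D - S.center C))
                ((k : ℂ) * (S.y j - S.center C)) * S.q j) := by
  rw [exactLM_eq hk hlevel, approxLM, ← Finset.sum_sub_distrib]
  refine Finset.sum_congr rfl fun C hC => ?_
  rw [sum_RH_eq hk hC (hlevel C hC)]
  have : ∀ n, S.EM k p C n * hankel (n - m) (k * ‖S.center D - S.center C‖)
      * phase (n - m) (S.center D - S.center C)
      = S.multipole k C n * S.kerM2L k D C m n - S.approxMultipole k p C n * S.kerM2L k D C m n :=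
    fun n => by rw [EM, kerM2L]; ring
  simp only [this, Finset.sum_sub_distrib]
  ring

/-- The error of the local-to-local translation. -/
theorem hasSum_L2L {k : ℝ} (hk : 0 < k)
    (hlevel : ∀ D ∈ S.tree.cells, 2 ≤ D.level →
      ∀ C ∈ S.wellSeparated D, D.level ≤ C.level + 2) {D : Cell}
    (hD : D ∈ S.tree.cells) (hD3 : 3 ≤ D.level) (p : ℕ) (m : ℤ) :
    HasSum (fun l : ℤ => S.exactLocal k D.parent l * S.kerL2L k D m l)
      ((∑ l ∈ Finset.Icc (-(p : ℤ)) (p : ℤ), S.exactLocal k D.parent l * S.kerL2L k D m l)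
        + ∑ L₁ ∈ Finset.Icc 2 (D.level - 1), ∑ C ∈ S.wellSeparated (D.ancestor L₁),
            ∑ j ∈ S.points C,
              RHbar m p ((k : ℂ) * (S.y j - S.center D.parent))
                ((k : ℂ) * (S.center D - S.center D.parent)) * S.q j) := by
  have hloc : ∀ l, S.exactLocal k D.parent l = S.farField k D.parent D (D.level - 1) l := by
    intro l
    rw [exactLocal_eq hk hlevel (S.tree.parent_mem_cells hD (by omega))
      (by rw [level_parent]; omega), farField_parent _ hD3]
  simp only [hloc]
  -- The full translation sums to the far field about the new centre, so it remains to see, cell by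
  -- cell, that the remainders are this field minus its truncated translation.
  convert hasSum_farField_L2L (S := S) hk hD3 m using 1
  rw [← eq_sub_iff_add_eq']
  simp only [farField, Finset.sum_mul]
  rw [Finset.sum_comm, ← Finset.sum_sub_distrib]
  refine Finset.sum_congr rfl fun L₁ hL => ?_
  rw [Finset.mem_Icc] at hL
  rw [Finset.sum_comm, ← Finset.sum_sub_distrib]
  exact Finset.sum_congr rfl fun C hC => sum_RHbar_eq hk (by omega) hC m p

end Configuration

end HelmholtzFMM

end

theorem theorem2 {ι : Type*} [Fintype ι] (S : Configuration ι) (k : ℝ) (hk : 0 < k) (p : ℕ)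
    (hlevel : ∀ D ∈ S.tree.cells, 2 ≤ D.level →
      ∀ C ∈ S.wellSeparated D, D.level ≤ C.level + 2)
    (D : Cell) (hD : D ∈ S.tree.cells) (hD2 : 2 ≤ D.level) (m : ℤ) :
    -- all series in the M2L part converge (absolutely)
    (∀ C ∈ S.wellSeparated D,
      (Summable fun n : ℤ => S.multipole k C n * S.kerM2L k D C m n) ∧
      ∀ j ∈ S.points C, Summable fun n : ℤ =>
        RHTerm (-m) ((k : ℂ) * (S.center D - S.center C)) ((k : ℂ) * (S.y j - S.center C)) n) ∧
    -- level 2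
    (D.level = 2 →
      S.EL k p D m =
        ∑ C ∈ S.wellSeparated D,
          ((∑ n ∈ Finset.Icc (-(p : ℤ)) (p : ℤ),
              S.EM k p C n * hankel (n - m) (k * ‖S.center D - S.center C‖)
                * phase (n - m) (S.center D - S.center C))
            + ∑ j ∈ S.points C,
                RH (-m) p ((k : ℂ) * (S.center D - S.center C))
                  ((k : ℂ) * (S.y j - S.center C)) * S.q j)) ∧
    -- levels at least 3
    (3 ≤ D.level →
      (Summable fun l : ℤ => S.exactLocal k D.parent l * S.kerL2L k D m l) ∧
      (∀ L₁ ∈ Finset.Icc 2 (D.level - 1), ∀ C ∈ S.wellSeparated (D.ancestor L₁),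
        ∀ j ∈ S.points C, Summable fun n : ℤ =>
          RHbarTerm m ((k : ℂ) * (S.y j - S.center D.parent))
            ((k : ℂ) * (S.center D - S.center D.parent)) n) ∧
      S.EL k p D m =
        (∑ C ∈ S.wellSeparated D,
          ((∑ n ∈ Finset.Icc (-(p : ℤ)) (p : ℤ),
              S.EM k p C n * hankel (n - m) (k * ‖S.center D - S.center C‖)
                * phase (n - m) (S.center D - S.center C))
            + ∑ j ∈ S.points C,
                RH (-m) p ((k : ℂ) * (S.center D - S.center C))
                  ((k : ℂ) * (S.y j - S.center C)) * S.q j))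
        + (∑ l ∈ Finset.Icc (-(p : ℤ)) (p : ℤ),
            S.EL k p D.parent l
              * (besselJ (l - m) (k * ‖S.center D - S.center D.parent‖) : ℂ)
              * phase (l - m) (S.center D - S.center D.parent))
        + ∑ L₁ ∈ Finset.Icc 2 (D.level - 1), ∑ C ∈ S.wellSeparated (D.ancestor L₁),
            ∑ j ∈ S.points C,
              RHbar m p ((k : ℂ) * (S.y j - S.center D.parent))
                ((k : ℂ) * (S.center D - S.center D.parent)) * S.q j) := by
  refine ⟨fun C hC => ?_, fun h2 => ?_, fun h3 => ⟨?_, fun L₁ hL C hC j hj => ?_, ?_⟩⟩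
  · have hl := hlevel D hD hD2 C hC
    exact ⟨(Configuration.hasSum_M2L hk hC hl m).summable, fun j hj =>
      (hasSum_RHTerm (Configuration.norm_M2L_lt hk hC hl hj) (-m)).summable⟩
  · rw [← Configuration.exactLM_sub_approxLM hk (hlevel D hD hD2), Configuration.EL,
      Configuration.exactLocal, Configuration.approxLocal, dif_neg (by omega), dif_neg (by omega)]
  · exact (Configuration.hasSum_L2L hk hlevel hD h3 p m).summable
  · rw [Finset.mem_Icc] at hL
    exact (hasSum_RHbarTerm (Configuration.norm_L2L_lt hk (by omega) hC hj)
      (Configuration.L2L_ne_zero hk (by omega)) m).summable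
  · rw [← Configuration.exactLM_sub_approxLM hk (hlevel D hD hD2), Configuration.EL,
      Configuration.exactLocal, Configuration.approxLocal, dif_pos h3, dif_pos h3,
      (Configuration.hasSum_L2L hk hlevel hD h3 p m).tsum_eq]
    -- The orders |l| > p are already in the remainders; for |l| ≤ p, exact minus computed parent
    -- moments give the inherited error.
    have : ∀ l, S.EL k p D.parent l
        * (besselJ (l - m) (k * ‖S.center D - S.center D.parent‖) : ℂ)
        * phase (l - m) (S.center D - S.center D.parent)
        = S.exactLocal k D.parent l * S.kerL2L k D m l
          - S.approxLocal k p D.parent l * S.kerL2L k D m l := fun l => by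
      rw [Configuration.EL, Configuration.kerL2L]; ring
    simp only [this, Finset.sum_sub_distrib]
    ring
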